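/- Let $(\mathcal A,\otimes,k)$ be a bicomplete abelian category with a closed symmetric monoidal structure, and let $\mathcal P$ be a symmetric operad in $\mathcal A$ (each $\mathcal P_n$ carrying a right action of $\Sigma_n$) that is reduced: $\mathcal P_0=0$, and the unit $k\to\mathcal P_1$ is an isomorphism. Write $\mathcal P(V)=\bigoplus_{n}\mathcal P_n\otimes_{\Sigma_n}V^{\otimes n}$ for the Schur functor, with the monad multiplication $\mu^{\mathcal P}:\mathcal P(\mathcal P(V))\to\mathcal P(V)$ induced by the composition of the operad. A $\mathcal P$-algebra is an algebra $(A,\mu^A:\mathcal P(A)\to A)$ over this monad. For objects $B,X$ of $\mathcal A$ put $$\mathcal P\circ(B|X)=\bigoplus_{n}\mathcal P_n\otimes_{\Sigma_n}\bigl((X\oplus B)^{\otimes n}/B^{\otimes n}\bigr);$$ it is identified with the kernel of $\mathcal P(X\oplus B)\to\mathcal P(B)$, so that $\mathcal P(X\oplus B)=\mathcal P\circ(B|X)\oplus\mathcal P(B)$. An internal action of a $\mathcal P$-algebra $B$ on a $\mathcal P$-algebra $X$ is a morphism $\rho:\mathcal P\circ(B|X)\to X$ of $\mathcal A$ such that 1.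 the composite $\mathcal P(X)\to\mathcal P\circ(B|X)\xrightarrow{\rho}X$, whose first arrow is induced by $X\hookrightarrow X\oplus B$, is $\mu^X$; 2. the two morphisms $\rho\circ\bigl(\mathcal P\circ(\mu^B|\rho)\bigr)$ and $\rho\circ\mu^{\mathcal P}$ from $\mathcal P\circ\bigl(\mathcal P(B)\,|\,\mathcal P\circ(B|X)\bigr)$ to $X$ are equal, where $\mu^{\mathcal P}$ here denotes the restriction $\mathcal P\circ(\mathcal P(B)|\mathcal P\circ(B|X))\to\mathcal P\circ(B|X)$ of the multiplication $\mathcal P(\mathcal P(X\oplus B))\to\mathcal P(X\oplus B)$ to the indicated summands. Let $\mathrm{Act}(\mathcal P\text{-alg})$ be the category whose objects are the triples $(B,X,\rho)$, with $\rho$ an internal action of $B$ on $X$, and whose morphisms $(B,X,\rho)\to(B',X',\rho')$ are the pairs of $\mathcal P$-algebra morphisms $g:B\to B'$, $f:X\to X'$ with $\rho'\circ(\mathcal P\circ(g|f))=f\circ\rho$. Let $\mathrm{SplitEpi}(\mathcal P\text{-alg})$ be the category of split short exact sequences $0\to X\xrightarrow{i}E\xrightarrow{p}B\to0$ of $\mathcal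 P$-algebras with a chosen section $s:B\to E$ of $p$ that is a morphism of $\mathcal P$-algebras; its morphisms are the triples of $\mathcal P$-algebra morphisms that commute with $i$, $p$ and $s$. **Theorem.** (a) For every internal action $\rho$ of $B$ on $X$, the morphism $$\mathcal P(X\oplus B)=\mathcal P\circ(B|X)\oplus\mathcal P(B)\xrightarrow{\begin{pmatrix}\rho&0\\0&\mu^B\end{pmatrix}}X\oplus B$$ makes $X\oplus B$ a $\mathcal P$-algebra, and $0\to X\to X\oplus B\to B\to 0$, with the canonical inclusions and projection and the section $B\to X\oplus B$, is a split short exact sequence of $\mathcal P$-algebras. (b) For every split short exact sequence $0\to X\xrightarrow{i}E\xrightarrow{p}B\to0$ of $\mathcal P$-algebras with section $s$, the unique morphism $\rho:\mathcal P\circ(B|X)\to X$ for which $i\circ\rho$ is the composite $\mathcal P\circ(B|X)\hookrightarrow\mathcal P(X\oplus B)\xrightarrow{\mathcal P((i,s))}\mathcal P(E)\xrightarrow{\mu^E}E$ is an internal action of $B$ on $X$. (c) The constructions (a) and (b), which act on morphisms by $(g,f)\mapsto(f,f\oplus g,g)$ and by $(f,h,g)\mapsto(g,f)$, are functors, and they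 are quasi-inverse equivalences of categories $$\mathrm{Act}(\mathcal P\text{-alg})\simeq\mathrm{SplitEpi}(\mathcal P\text{-alg}).$$ -/

import Mathlib

open CategoryTheory Limits MonoidalCategory

universe v u

noncomputable section

namespace OperadAction

/-! ### Finite sequences and block permutations -/

/-- Finite sequences of length `n`, built by appending an entry on the right. -/
inductive Vec (α : Type*) : ℕ → Type _
  | nil : Vec α 0
  | snoc {n : ℕ} (v : Vec α n) (a : α) : Vec α (n + 1)

namespace Vec

variable {α β : Type*}

/-- Apply a function to every entry. -/
def map (f : α → β) : {n : ℕ} → Vec α n → Vec β n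
  | _, nil => nil
  | _, snoc v a => snoc (map f v) (f a)

/-- Concatenation. -/
def append {m : ℕ} (u : Vec α m) : {n : ℕ} → Vec α n → Vec α (m + n)
  | _, nil => u
  | _, snoc v a => snoc (append u v) a

/-- The constant sequence. -/
def replicate (a : α) : (n : ℕ) → Vec α n
  | 0 => nil
  | n + 1 => snoc (replicate a n) a

/-- The sum of the entries. -/
def sum : {n : ℕ} → Vec ℕ n → ℕ
  | _, nil => 0
  | _, snoc v a => sum v + a

/-- Concatenation of a sequence of sequences. -/
def flatten : {n : ℕ} → (v : Vec (Σ m, Vec α m) n) → Vec α (v.map Sigma.fst).sum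
  | _, nil => nil
  | _, snoc v l => append (flatten v) l.2

/-- Exchange the last two entries (if there are two). -/
def swapLast : {n : ℕ} → Vec α n → Vec α n
  | _, nil => nil
  | _, snoc nil a => snoc nil a
  | _, snoc (snoc v a) b => snoc (snoc v b) a

/-- Exchange the entries at positions `j` and `j + 1`, counted from the right and from `0`
(nothing happens if there are no such positions). -/
def swapAt : (j : ℕ) → {n : ℕ} → Vec α n → Vec α n
  | 0, _, v => swapLast v
  | _ + 1, _, nil => nil
  | j + 1, _, snoc v a => snoc (swapAt j v) a

theorem sum_append {m n : ℕ} (u : Vec ℕ m) (v : Vec ℕ n) :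
    (u.append v).sum = u.sum + v.sum := by
  induction v with
  | nil => rfl
  | snoc v a ih => simp only [append, sum, ih, Nat.add_assoc]

theorem sum_replicate_one (n : ℕ) : (replicate 1 n).sum = n := by
  induction n with
  | zero => rfl
  | succ n ih => simp only [replicate, sum, ih]

theorem sum_flatten {n : ℕ} (v : Vec (Σ m, Vec ℕ m) n) :
    v.flatten.sum = (v.map fun l => l.2.sum).sum := by
  induction v with
  | nil => rfl
  | snoc v l ih => simp only [flatten, map, sum, sum_append, ih]

end Vec

/-- The block sum `e ⊕ f` of two bijections: `e` on the first block, `f` on the second one. -/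
def blockSum {a a' b b' : ℕ} (e : Fin a ≃ Fin a') (f : Fin b ≃ Fin b') :
    Fin (a + b) ≃ Fin (a' + b') :=
  finSumFinEquiv.symm.trans ((e.sumCongr f).trans finSumFinEquiv)

/-- The bijection that exchanges the last two of three consecutive blocks of sizes `s`, `a`, `b`,
keeping the order inside each block. -/
def blockComm (s a b : ℕ) : Fin (s + a + b) ≃ Fin (s + b + a) where
  toFun i := ⟨if i.1 < s then i.1 else if i.1 < s + a then i.1 + b else i.1 - a, by
    have := i.2; split_ifs <;> omega⟩
  invFun i := ⟨if i.1 < s then i.1 else if i.1 < s + b then i.1 + a else i.1 - b, by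
    have := i.2; split_ifs <;> omega⟩
  left_inv i := by
    have := i.2
    ext; dsimp only; split_ifs <;> omega
  right_inv i := by
    have := i.2
    ext; dsimp only; split_ifs <;> omega

/-- The transposition of the last two elements of `Fin n` (the identity if `n < 2`). -/
def swapLastPerm : (n : ℕ) → Fin n ≃ Fin n
  | 0 => Equiv.refl _
  | 1 => Equiv.refl _
  | n + 2 => blockComm n 1 1

/-- The adjacent transposition of the positions `j` and `j + 1` of `Fin n`, counted from the right
and from `0` (the identity if `n < j + 2`). For fixed `n`, these generate the symmetric group. -/
def swapPerm : (j n : ℕ) → (Fin n ≃ Fin n)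
  | 0, n => swapLastPerm n
  | _ + 1, 0 => Equiv.refl _
  | j + 1, n + 1 => blockSum (swapPerm j n) (Equiv.refl (Fin 1))

/-- The block permutation that exchanges the last two blocks, for blocks of sizes `k`. -/
def blockSwapLast : {n : ℕ} → (k : Vec ℕ n) → (Fin k.sum ≃ Fin k.swapLast.sum)
  | _, .nil => Equiv.refl _
  | _, .snoc .nil _ => Equiv.refl _
  | _, .snoc (.snoc k a) b => blockComm k.sum a b

/-- The block permutation induced by `swapPerm j n` on consecutive blocks of sizes `k₁, …, kₙ`. -/
def blockSwap : (j : ℕ) → {n : ℕ} → (k : Vec ℕ n) → (Fin k.sum ≃ Fin (k.swapAt j).sum)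
  | 0, _, k => blockSwapLast k
  | _ + 1, _, .nil => Equiv.refl _
  | j + 1, _, .snoc k a => blockSum (blockSwap j k) (Equiv.refl (Fin a))

/-- Sequences of bijections `Fin kᵢ ≃ Fin k'ᵢ`, for `i = 1, …, n`. -/
inductive VecEquiv : {n : ℕ} → Vec ℕ n → Vec ℕ n → Type
  | nil : VecEquiv .nil .nil
  | snoc {n : ℕ} {k k' : Vec ℕ n} {a a' : ℕ} (E : VecEquiv k k') (e : Fin a ≃ Fin a') :
      VecEquiv (k.snoc a) (k'.snoc a')

/-- The block sum of a sequence of bijections. -/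
def VecEquiv.sum : {n : ℕ} → {k k' : Vec ℕ n} → VecEquiv k k' → (Fin k.sum ≃ Fin k'.sum)
  | _, _, _, .nil => Equiv.refl _
  | _, _, _, .snoc E e => blockSum E.sum e

/-! ### Tensor products of finite sequences of objects -/

section Tensor

variable {C : Type u} [Category.{v} C] [MonoidalCategory C]

/-- The tensor product `F a₁ ⊗ ⋯ ⊗ F aₙ`. -/
def tens {α : Type*} (F : α → C) : {n : ℕ} → Vec α n → C
  | _, .nil => 𝟙_ C
  | _, .snoc v a => tens F v ⊗ F a

/-- The tensor product of the morphisms `φ aᵢ`. -/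
def tensMap {α β : Type*} {F : α → C} {G : β → C} (f : α → β) (φ : ∀ a, F a ⟶ G (f a)) :
    {n : ℕ} → (v : Vec α n) → (tens F v ⟶ tens G (v.map f))
  | _, .nil => 𝟙 _
  | _, .snoc v a => tensMap f φ v ⊗ₘ φ a

/-- The isomorphism between the tensor product of two blocks and that of their concatenation. -/
def tensAppend {α : Type*} (F : α → C) {m : ℕ} (u : Vec α m) :
    {n : ℕ} → (v : Vec α n) → (tens F u ⊗ tens F v ⟶ tens F (u.append v))
  | _, .nil => (ρ_ _).hom
  | _, .snoc v a => (α_ _ _ _).inv ≫ tensAppend F u v ▷ F a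

/-- The tensor power `X^{⊗ n}`. -/
def tpow (X : C) : ℕ → C
  | 0 => 𝟙_ C
  | n + 1 => tpow X n ⊗ X

/-- Functoriality of tensor powers. -/
def tpowMap {X Y : C} (f : X ⟶ Y) : (n : ℕ) → (tpow X n ⟶ tpow Y n)
  | 0 => 𝟙 _
  | n + 1 => tpowMap f n ⊗ₘ f

/-- The isomorphism `X^{⊗ a} ⊗ X^{⊗ b} ≅ X^{⊗ (a + b)}`. -/
def tpowAdd (X : C) (a : ℕ) : (b : ℕ) → (tpow X a ⊗ tpow X b ≅ tpow X (a + b))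
  | 0 => ρ_ _
  | b + 1 => (α_ _ _ _).symm ≪≫ whiskerRightIso (tpowAdd X a b) X

/-- The tensor product of a sequence of morphisms `F a → X`, as a morphism to a tensor power. -/
def tensToPow {α : Type*} {F : α → C} {X : C} (φ : ∀ a, F a ⟶ X) :
    {n : ℕ} → (v : Vec α n) → (tens F v ⟶ tpow X n)
  | _, .nil => 𝟙 _
  | _, .snoc v a => tensToPow φ v ⊗ₘ φ a

variable [SymmetricCategory C]

/-- The symmetry exchanging the last two of three tensor factors. -/
def rightSwap (A B D : C) : (A ⊗ B) ⊗ D ⟶ (A ⊗ D) ⊗ B :=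
  (α_ A B D).hom ≫ A ◁ (β_ B D).hom ≫ (α_ A D B).inv

/-- The symmetry exchanging the last two factors. -/
def tensSwapLast {α : Type*} (F : α → C) :
    {n : ℕ} → (v : Vec α n) → (tens F v ⟶ tens F v.swapLast)
  | _, .nil => 𝟙 _
  | _, .snoc .nil _ => 𝟙 _
  | _, .snoc (.snoc v a) b => rightSwap (tens F v) (F a) (F b)

/-- The symmetry exchanging the factors at positions `j` and `j + 1`, counted from the right. -/
def tensSwap {α : Type*} (F : α → C) :
    (j : ℕ) → {n : ℕ} → (v : Vec α n) → (tens F v ⟶ tens F (v.swapAt j))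
  | 0, _, v => tensSwapLast F v
  | _ + 1, _, .nil => 𝟙 _
  | j + 1, _, .snoc v a => tensSwap F j v ▷ F a

/-- The symmetry exchanging the last two factors of `X^{⊗ n}`. -/
def tpowSwapLast (X : C) : (n : ℕ) → (tpow X n ⟶ tpow X n)
  | 0 => 𝟙 _
  | 1 => 𝟙 _
  | n + 2 => rightSwap (tpow X n) X X

/-- The action of the adjacent transposition `swapPerm j n` on `X^{⊗ n}`. -/
def tpowSwap (X : C) : (j n : ℕ) → (tpow X n ⟶ tpow X n)
  | 0, n => tpowSwapLast X n
  | _ + 1, 0 => 𝟙 _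
  | j + 1, n + 1 => tpowSwap X j n ▷ X

/-- The rearrangement
`⨂ᵢ (F mᵢ ⊗ ⨂ⱼ F lᵢⱼ) → (⨂ᵢ F mᵢ) ⊗ (⨂ᵢ ⨂ⱼ F lᵢⱼ)` given by the symmetry. -/
def unzipTens (F : ℕ → C) : {n : ℕ} → (v : Vec (Σ m, Vec ℕ m) n) →
    (tens (fun l : Σ m, Vec ℕ m => F l.1 ⊗ tens F l.2) v ⟶
      tens F (v.map Sigma.fst) ⊗ tens F v.flatten)
  | _, .nil => (λ_ (𝟙_ C)).inv
  | _, .snoc v l => unzipTens F v ▷ _ ≫ tensorμ _ _ _ _ ≫ _ ◁ tensAppend F v.flatten l.2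

/-- The rearrangement
`⨂ᵢ (F kᵢ ⊗ X^{⊗ kᵢ}) → (⨂ᵢ F kᵢ) ⊗ X^{⊗ (k₁ + ⋯ + kₙ)}` given by the symmetry. -/
def unzipPow (F : ℕ → C) (X : C) : {n : ℕ} → (k : Vec ℕ n) →
    (tens (fun a : ℕ => F a ⊗ tpow X a) k ⟶ tens F k ⊗ tpow X k.sum)
  | _, .nil => (λ_ (𝟙_ C)).inv
  | _, .snoc k a => unzipPow F X k ▷ _ ≫ tensorμ _ _ _ _ ≫ _ ◁ (tpowAdd X k.sum a).hom

/-- The tensor product of a sequence of right actions of bijections. -/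
def tensAct {F : ℕ → C} (act : ∀ {m n : ℕ}, (Fin m ≃ Fin n) → (F n ⟶ F m)) :
    {n : ℕ} → {k k' : Vec ℕ n} → VecEquiv k k' → (tens F k' ⟶ tens F k)
  | _, _, _, .nil => 𝟙 _
  | _, _, _, .snoc E e => tensAct act E ⊗ₘ act e

/-- The morphism `𝟙 → F 1 ⊗ ⋯ ⊗ F 1` given by a morphism `𝟙 → F 1`. -/
def tensOne {F : ℕ → C} (one : 𝟙_ C ⟶ F 1) : (n : ℕ) → (𝟙_ C ⟶ tens F (Vec.replicate 1 n))
  | 0 => 𝟙 _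
  | n + 1 => (λ_ (𝟙_ C)).inv ≫ (tensOne one n ⊗ₘ one)

end Tensor

/-! ### Symmetric operads -/

/-- A symmetric operad in a symmetric monoidal category. The right actions of the symmetric groups
on the objects of `n`-ary operations are recorded as the (contravariant) action of all bijections
`Fin m ≃ Fin n`; such a bijection exists only if `m = n`. Equivariance of the composition with
respect to the outer symmetric group is stated for the adjacent transpositions, which generate. -/
structure SymmOperad (C : Type u) [Category.{v} C] [MonoidalCategory C] [SymmetricCategory C] where
  /-- the object of `n`-ary operations -/
  obj : ℕ → C
  /-- the right action of the symmetric groups -/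
  act : ∀ {m n : ℕ}, (Fin m ≃ Fin n) → (obj n ⟶ obj m)
  act_refl : ∀ n : ℕ, act (Equiv.refl (Fin n)) = 𝟙 (obj n)
  act_trans : ∀ {l m n : ℕ} (e : Fin l ≃ Fin m) (f : Fin m ≃ Fin n),
    act (e.trans f) = act f ≫ act e
  /-- the operadic unit -/
  one : 𝟙_ C ⟶ obj 1
  /-- the operadic composition `P n ⊗ P k₁ ⊗ ⋯ ⊗ P kₙ ⟶ P (k₁ + ⋯ + kₙ)` -/
  comp : ∀ {n : ℕ} (k : Vec ℕ n), obj n ⊗ tens obj k ⟶ obj k.sum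
  one_comp : ∀ a : ℕ, (one ⊗ₘ (λ_ (obj a)).inv) ≫ comp (Vec.nil.snoc a) =
    (λ_ (obj a)).hom ≫ act (finCongr (Nat.zero_add a))
  comp_one : ∀ n : ℕ, (ρ_ (obj n)).inv ≫ obj n ◁ tensOne one n ≫ comp (Vec.replicate 1 n) =
    act (finCongr (Vec.sum_replicate_one n))
  comp_assoc : ∀ {n : ℕ} (v : Vec (Σ m, Vec ℕ m) n),
    obj n ◁ unzipTens obj v ≫ (α_ _ _ _).inv ≫ comp (v.map Sigma.fst) ▷ _ ≫ comp v.flatten =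
      obj n ◁ tensMap (fun l : Σ m, Vec ℕ m => l.2.sum) (fun l => comp l.2) v ≫
        comp (v.map fun l => l.2.sum) ≫ act (finCongr (Vec.sum_flatten v))
  comp_act_inner : ∀ {n : ℕ} {k k' : Vec ℕ n} (E : VecEquiv k k'),
    obj n ◁ tensAct act E ≫ comp k = comp k' ≫ act E.sum
  comp_act_outer : ∀ {n : ℕ} (j : ℕ) (k : Vec ℕ n),
    act (swapPerm j n) ▷ tens obj k ≫ comp k =
      obj n ◁ tensSwap obj j k ≫ comp (k.swapAt j) ≫ act (blockSwap j k)

/-- The operad is reduced: `P 0 = 0`, and `P 1` is the tensor unit, through the operadic unit. -/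
structure SymmOperad.IsReduced {C : Type u} [Category.{v} C] [MonoidalCategory C]
    [SymmetricCategory C] (P : SymmOperad C) : Prop where
  isZero_zero : IsZero (P.obj 0)
  isIso_one : IsIso P.one

/-! ### Facts on block permutations and tensor powers -/

theorem blockSum_refl (a b : ℕ) :
    blockSum (Equiv.refl (Fin a)) (Equiv.refl (Fin b)) = Equiv.refl (Fin (a + b)) := by
  ext i; simp [blockSum]

theorem blockSum_trans {a a' a'' b b' b'' : ℕ} (e : Fin a ≃ Fin a') (e' : Fin a' ≃ Fin a'')
    (f : Fin b ≃ Fin b') (f' : Fin b' ≃ Fin b'') :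
    blockSum (e.trans e') (f.trans f') = (blockSum e f).trans (blockSum e' f') := by
  apply Equiv.ext
  intro i
  induction i using Fin.addCases <;> simp [blockSum]

theorem blockSum_left_val {a a' b b' : ℕ} (e : Fin a ≃ Fin a') (f : Fin b ≃ Fin b')
    (i : Fin (a + b)) (h : i.1 < a) : (blockSum e f i).1 = (e ⟨i.1, h⟩).1 := by
  have key : ∀ x : Fin a, blockSum e f (Fin.castAdd b x) = Fin.castAdd b' (e x) := by
    intro x; simp [blockSum]
  exact congrArg Fin.val (key ⟨i.1, h⟩)

theorem blockSum_right_val {a a' b b' : ℕ} (e : Fin a ≃ Fin a') (f : Fin b ≃ Fin b')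
    (i : Fin (a + b)) (h : ¬ i.1 < a) :
    (blockSum e f i).1 = a' + (f ⟨i.1 - a, by omega⟩).1 := by
  have key : ∀ x : Fin b, blockSum e f (Fin.natAdd a x) = Fin.natAdd a' (f x) := by
    intro x; simp [blockSum]
  have hi : i = Fin.natAdd a ⟨i.1 - a, by omega⟩ := by ext; simp; omega
  exact (congrArg (fun x => (blockSum e f x).1) hi).trans (congrArg Fin.val (key _))

theorem blockSum_zero {a a' : ℕ} (e : Fin a ≃ Fin a') :
    blockSum e (Equiv.refl (Fin 0)) = e := by
  apply Equiv.ext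
  intro i
  ext
  exact blockSum_left_val e _ i i.2

theorem blockSum_succ {a a' b b' : ℕ} (e : Fin a ≃ Fin a') (f : Fin b ≃ Fin b') :
    blockSum e (blockSum f (Equiv.refl (Fin 1))) =
      blockSum (blockSum e f) (Equiv.refl (Fin 1)) := by
  apply Equiv.ext
  intro i
  ext
  have hi := i.2
  by_cases h1 : i.1 < a
  · rw [blockSum_left_val _ _ _ h1, blockSum_left_val _ _ _ (by omega),
      blockSum_left_val _ _ _ (by simpa using h1)]
  · by_cases h2 : i.1 < a + b
    · rw [blockSum_right_val _ _ _ h1, blockSum_left_val _ _ _ (by simp; omega),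
        blockSum_left_val _ _ _ (by simpa using h2), blockSum_right_val _ _ _ (by simpa using h1)]
    · rw [blockSum_right_val _ _ _ h1, blockSum_right_val _ _ _ (by simp; omega),
        blockSum_right_val _ _ _ (by simpa using h2)]
      simp

theorem blockComm_zero_left (s a : ℕ) : blockComm s 0 a = Equiv.refl (Fin (s + a)) := by
  apply Equiv.ext; intro i; ext
  have := i.2
  change (if i.1 < s then _ else _) = i.1
  split_ifs <;> omega

theorem blockComm_zero_right (s a : ℕ) : blockComm s a 0 = Equiv.refl (Fin (s + a)) := by
  apply Equiv.ext; intro i; ext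
  have := i.2
  change (if i.1 < s then _ else _) = i.1
  split_ifs <;> omega

theorem blockComm_succ_one (s a : ℕ) : blockComm s (a + 1) 1 =
    (blockComm (s + a) 1 1).trans (blockSum (blockComm s a 1) (Equiv.refl (Fin 1))) := by
  apply Equiv.ext; intro i; ext
  have hi := i.2
  rw [Equiv.trans_apply]
  by_cases h : (blockComm (s + a) 1 1 i).1 < s + a + 1
  · rw [blockSum_left_val _ _ _ h]
    simp only [blockComm, Equiv.coe_fn_mk] at h ⊢
    split_ifs at h ⊢ <;> omega
  · rw [blockSum_right_val _ _ _ h]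
    simp only [blockComm, Equiv.coe_fn_mk] at h ⊢
    simp
    split_ifs at h ⊢ <;> omega

theorem blockComm_succ (s a b : ℕ) : blockComm s a (b + 1) =
    Equiv.trans (blockSum (blockComm s a b) (Equiv.refl (Fin 1))) (blockComm (s + b) a 1) := by
  apply Equiv.ext; intro i; ext
  have hi := i.2
  rw [Equiv.trans_apply]
  by_cases h : i.1 < s + a + b
  · have e := blockSum_left_val (blockComm s a b) (Equiv.refl (Fin 1)) i h
    simp only [blockComm, Equiv.coe_fn_mk] at e ⊢
    rw [e]
    split_ifs <;> omega
  · have e := blockSum_right_val (blockComm s a b) (Equiv.refl (Fin 1)) i h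
    simp only [blockComm, Equiv.coe_fn_mk, Equiv.refl_apply] at e ⊢
    rw [e]
    split_ifs <;> omega

theorem swapPerm_eq_refl : ∀ j n : ℕ, n ≤ j + 1 → swapPerm j n = Equiv.refl _
  | 0, 0, _ => rfl
  | 0, 1, _ => rfl
  | 0, n + 2, h => by omega
  | _ + 1, 0, _ => rfl
  | j + 1, n + 1, h => by
    rw [swapPerm, swapPerm_eq_refl j n (by omega), blockSum_refl]

section Tensor

variable {C : Type u} [Category.{v} C] [MonoidalCategory C]

theorem tpowMap_id (X : C) (n : ℕ) : tpowMap (𝟙 X) n = 𝟙 _ := by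
  induction n with
  | zero => rfl
  | succ n ih => simp only [tpowMap, ih, id_tensorHom_id]; rfl

theorem tpowMap_comp {X Y Z : C} (f : X ⟶ Y) (g : Y ⟶ Z) (n : ℕ) :
    tpowMap (f ≫ g) n = tpowMap f n ≫ tpowMap g n := by
  induction n with
  | zero => exact (Category.comp_id _).symm
  | succ n ih =>
    simp only [tpowMap, ih]
    exact (tensorHom_comp_tensorHom _ _ _ _).symm

theorem whisker_step {A A' B B' X Y : C} {t : A ⟶ A'} {s : B ⟶ B'} {φ : A ⟶ B} {ψ : A' ⟶ B'}
    (f : X ⟶ Y) (h : φ ≫ s = t ≫ ψ) : (φ ⊗ₘ f) ≫ s ▷ Y = t ▷ X ≫ (ψ ⊗ₘ f) := by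
  rw [tensorHom_comp_whiskerRight, whiskerRight_comp_tensorHom, h]

variable [SymmetricCategory C]

theorem rightSwap_natural {A B D A' B' D' : C} (f : A ⟶ A') (g : B ⟶ B') (h : D ⟶ D') :
    ((f ⊗ₘ g) ⊗ₘ h) ≫ rightSwap A' B' D' = rightSwap A B D ≫ ((f ⊗ₘ h) ⊗ₘ g) := by
  simp only [rightSwap, Category.assoc]
  rw [associator_naturality_assoc, tensorHom_comp_whiskerLeft_assoc,
    BraidedCategory.braiding_naturality, ← associator_inv_naturality,
    whiskerLeft_comp_tensorHom_assoc]

theorem rightSwap_step {A B D X : C} (m : A ⊗ B ⟶ D) :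
    A ◁ rightSwap B X X ≫ (α_ A (B ⊗ X) X).inv ≫ ((α_ A B X).inv ≫ m ▷ X) ▷ X =
      ((α_ A (B ⊗ X) X).inv ≫ ((α_ A B X).inv ≫ m ▷ X) ▷ X) ≫ rightSwap D X X := by
  have h : ((m ▷ X) ▷ X) ≫ rightSwap D X X = rightSwap (A ⊗ B) X X ≫ (m ▷ X) ▷ X := by
    simpa using rightSwap_natural m (𝟙 X) (𝟙 X)
  simp only [comp_whiskerRight, Category.assoc, h]
  simp only [← Category.assoc]
  congr 1
  simp only [rightSwap]
  monoidal

theorem tpowSwap_natural {X Y : C} (f : X ⟶ Y) : ∀ j n : ℕ,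
    tpowMap f n ≫ tpowSwap Y j n = tpowSwap X j n ≫ tpowMap f n
  | 0, 0 => rfl
  | 0, 1 => by simp [tpowSwap, tpowSwapLast]
  | 0, n + 2 => rightSwap_natural _ _ _
  | _ + 1, 0 => rfl
  | j + 1, n + 1 => by
    have ih := tpowSwap_natural f j n
    exact whisker_step f ih

theorem tpowSwap_eq_id (X : C) : ∀ j n : ℕ, n ≤ j + 1 → tpowSwap X j n = 𝟙 _
  | 0, 0, _ => rfl
  | 0, 1, _ => rfl
  | 0, n + 2, h => by omega
  | _ + 1, 0, _ => rfl
  | j + 1, n + 1, h => by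
    rw [tpowSwap, tpowSwap_eq_id X j n (by omega), id_whiskerRight]; rfl

theorem tensToPow_swapLast {α : Type*} {F : α → C} {X : C} (φ : ∀ a, F a ⟶ X) :
    ∀ {n : ℕ} (v : Vec α n), tensToPow φ v ≫ tpowSwapLast X n =
      tensSwapLast F v ≫ tensToPow φ v.swapLast
  | _, .nil => rfl
  | _, .snoc .nil a => by
      simp only [tpowSwapLast, tensSwapLast, Vec.swapLast]
      erw [Category.comp_id, Category.id_comp]
  | _, .snoc (.snoc v a) b => rightSwap_natural _ _ _

theorem tensToPow_swap {α : Type*} {F : α → C} {X : C} (φ : ∀ a, F a ⟶ X) :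
    ∀ (j : ℕ) {n : ℕ} (v : Vec α n), tensToPow φ v ≫ tpowSwap X j n =
      tensSwap F j v ≫ tensToPow φ (v.swapAt j)
  | 0, _, v => tensToPow_swapLast φ v
  | _ + 1, _, .nil => rfl
  | j + 1, _, .snoc v a => by
    have ih := tensToPow_swap φ j v
    exact whisker_step (φ a) ih

/-- `h` is a composite of adjacent symmetries that realizes the bijection `e`. -/
inductive Realizes (X : C) : ∀ {m n : ℕ}, (Fin m ≃ Fin n) → (tpow X m ⟶ tpow X n) → Prop
  | refl (n : ℕ) : Realizes X (Equiv.refl (Fin n)) (𝟙 _)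
  | trans {l m n : ℕ} {e : Fin l ≃ Fin m} {f : Fin m ≃ Fin n} {g : tpow X l ⟶ tpow X m}
      {h : tpow X m ⟶ tpow X n} (H : Realizes X e g) (K : Realizes X f h) :
      Realizes X (e.trans f) (g ≫ h)
  | swap (j n : ℕ) : Realizes X (swapPerm j n) (tpowSwap X j n)

theorem Realizes.snoc {X : C} {m n : ℕ} {e : Fin m ≃ Fin n} {h : tpow X m ⟶ tpow X n}
    (H : Realizes X e h) :
    Realizes X (m := m + 1) (n := n + 1) (blockSum e (Equiv.refl (Fin 1))) (h ▷ X) := by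
  induction H with
  | refl n =>
    rw [blockSum_refl, id_whiskerRight]; exact Realizes.refl (n + 1)
  | trans H K ih ih' =>
    have := Realizes.trans ih ih'
    rw [← blockSum_trans] at this
    rw [comp_whiskerRight]
    exact this
  | swap j n => exact Realizes.swap (j + 1) (n + 1)

theorem Realizes.blockSum_left {X : C} {m n : ℕ} {e : Fin m ≃ Fin n} {h : tpow X m ⟶ tpow X n}
    (H : Realizes X e h) (b : ℕ) : ∃ g : tpow X (m + b) ⟶ tpow X (n + b),
      Realizes X (blockSum e (Equiv.refl (Fin b))) g ∧
      h ▷ tpow X b ≫ (tpowAdd X n b).hom = (tpowAdd X m b).hom ≫ g := by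
  induction b with
  | zero => exact ⟨h, by rw [blockSum_zero]; exact H, by simp [tpowAdd, tpow]⟩
  | succ b ih =>
    obtain ⟨g, hg, hg'⟩ := ih
    refine ⟨g ▷ X, ?_, ?_⟩
    · have := hg.snoc
      rwa [← blockSum_succ, blockSum_refl] at this
    · simp only [tpowAdd, tpow, Iso.trans_hom, Iso.symm_hom, whiskerRightIso_hom, Category.assoc]
      rw [← comp_whiskerRight, ← hg', comp_whiskerRight, associator_inv_naturality_left_assoc]

theorem Realizes.blockSum_right (X : C) (a : ℕ) : ∀ (j b : ℕ),
    ∃ g : tpow X (a + b) ⟶ tpow X (a + b),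
      Realizes X (blockSum (Equiv.refl (Fin a)) (swapPerm j b)) g ∧
      tpow X a ◁ tpowSwap X j b ≫ (tpowAdd X a b).hom = (tpowAdd X a b).hom ≫ g
  | 0, 0 => ⟨𝟙 _, by
      rw [swapPerm_eq_refl 0 0 (by omega), blockSum_refl]; exact .refl _, by
      simp [tpowSwap_eq_id]⟩
  | 0, 1 => ⟨𝟙 _, by
      rw [swapPerm_eq_refl 0 1 (by omega), blockSum_refl]; exact .refl _, by
      simp [tpowSwap_eq_id]⟩
  | 0, b + 2 => ⟨tpowSwap X 0 (a + b + 2), by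
      have h : blockSum (Equiv.refl (Fin a)) (swapPerm 0 (b + 2)) = swapPerm 0 (a + b + 2) := by
        apply Equiv.ext; intro i; ext
        have hi := i.2
        by_cases h : i.1 < a
        · rw [blockSum_left_val _ _ _ h]
          simp only [swapPerm, swapLastPerm, blockComm, Equiv.coe_fn_mk, Equiv.refl_apply]
          split_ifs <;> omega
        · rw [blockSum_right_val _ _ _ h]
          simp only [swapPerm, swapLastPerm, blockComm, Equiv.coe_fn_mk]
          split_ifs <;> omega
      rw [h]; exact Realizes.swap 0 (a + b + 2), by
      exact rightSwap_step (tpowAdd X a b).hom⟩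
  | j + 1, 0 => ⟨𝟙 _, by
      rw [swapPerm_eq_refl _ 0 (by omega), blockSum_refl]; exact .refl _, by
      simp [tpowSwap_eq_id]⟩
  | j + 1, b + 1 => by
    obtain ⟨g, hg, hg'⟩ := Realizes.blockSum_right X a j b
    refine ⟨g ▷ X, ?_, ?_⟩
    · have := hg.snoc
      rwa [← blockSum_succ] at this
    · simp only [tpowAdd, tpow, tpowSwap, Iso.trans_hom, Iso.symm_hom, whiskerRightIso_hom,
        Category.assoc]
      rw [← comp_whiskerRight, ← hg', comp_whiskerRight, associator_inv_naturality_middle_assoc]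

end Tensor

section Symmetry

variable {C : Type u} [Category.{v} C] [MonoidalCategory C] [SymmetricCategory C]

theorem tensorμ_braiding (A₁ A₂ B₁ B₂ : C) :
    tensorμ A₁ A₂ B₁ B₂ ≫ ((β_ A₁ B₁).hom ⊗ₘ (β_ A₂ B₂).hom) =
      (β_ (A₁ ⊗ A₂) (B₁ ⊗ B₂)).hom ≫ tensorμ B₁ B₂ A₁ A₂ := by
  simp only [tensorμ, BraidedCategory.braiding_tensor_left_hom,
    BraidedCategory.braiding_tensor_right_hom]
  have h : (β_ A₁ B₂).hom ≫ (β_ B₂ A₁).hom = 𝟙 _ := SymmetricCategory.symmetry _ _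
  have h' : B₁ ◁ ((β_ A₁ B₂).hom ≫ (β_ B₂ A₁).hom) ▷ A₂ = 𝟙 _ := by rw [h]; simp
  symm
  calc
    _ = 𝟙 _ ⊗≫ A₁ ◁ (β_ A₂ B₁).hom ▷ B₂ ⊗≫ ((A₁ ⊗ B₁) ◁ (β_ A₂ B₂).hom ≫
          (β_ A₁ B₁).hom ▷ (B₂ ⊗ A₂)) ⊗≫
          B₁ ◁ ((β_ A₁ B₂).hom ≫ (β_ B₂ A₁).hom) ▷ A₂ ⊗≫ 𝟙 _ := by
      rw [whisker_exchange]
      monoidal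
    _ = _ := by
      rw [h', whisker_exchange, MonoidalCategory.tensorHom_def]
      monoidal

theorem tensorμ_rightSwap (T₁ T₂ A₁ A₂ B₁ B₂ : C) :
    rightSwap (T₁ ⊗ T₂) (A₁ ⊗ A₂) (B₁ ⊗ B₂) ≫ tensorμ T₁ T₂ B₁ B₂ ▷ (A₁ ⊗ A₂) ≫
        tensorμ (T₁ ⊗ B₁) (T₂ ⊗ B₂) A₁ A₂ =
      tensorμ T₁ T₂ A₁ A₂ ▷ (B₁ ⊗ B₂) ≫ tensorμ (T₁ ⊗ A₁) (T₂ ⊗ A₂) B₁ B₂ ≫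
        (rightSwap T₁ A₁ B₁ ⊗ₘ rightSwap T₂ A₂ B₂) := by
  have key : ∀ X₁ X₂ Y₁ Y₂ Z₁ Z₂ : C, tensorμ X₁ X₂ Y₁ Y₂ ▷ (Z₁ ⊗ Z₂) ≫
        tensorμ (X₁ ⊗ Y₁) (X₂ ⊗ Y₂) Z₁ Z₂ = (α_ (X₁ ⊗ X₂) (Y₁ ⊗ Y₂) (Z₁ ⊗ Z₂)).hom ≫
        ((X₁ ⊗ X₂) ◁ tensorμ Y₁ Y₂ Z₁ Z₂) ≫ tensorμ X₁ X₂ (Y₁ ⊗ Z₁) (Y₂ ⊗ Z₂) ≫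
        ((α_ X₁ Y₁ Z₁).inv ⊗ₘ (α_ X₂ Y₂ Z₂).inv) := by
    intro X₁ X₂ Y₁ Y₂ Z₁ Z₂
    rw [← tensor_associativity_assoc]
    simp
  rw [key, reassoc_of% key]
  simp only [rightSwap, Category.assoc, Iso.inv_hom_id_assoc]
  congr 1
  rw [← whiskerLeft_comp_assoc, ← tensorμ_braiding, tensorHom_comp_tensorHom]
  simp only [Iso.inv_hom_id_assoc]
  rw [← tensorHom_comp_tensorHom, ← tensorμ_natural_right_assoc, whiskerLeft_comp_assoc]

theorem rightSwap_tensor_middle (S A X Y : C) :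
    (α_ S A X).inv ▷ Y ≫ rightSwap (S ⊗ A) X Y ≫ rightSwap S A Y ▷ X =
      rightSwap S (A ⊗ X) Y ≫ (α_ (S ⊗ Y) A X).inv := by
  simp only [rightSwap, BraidedCategory.braiding_tensor_left_hom]
  monoidal

theorem rightSwap_tensor_right (S A B X : C) :
    (α_ (S ⊗ A) B X).inv ≫ rightSwap S A B ▷ X ≫ rightSwap (S ⊗ B) A X =
      rightSwap S A (B ⊗ X) ≫ (α_ S B X).inv ▷ A := by
  simp only [rightSwap, BraidedCategory.braiding_tensor_right_hom]
  monoidal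

theorem rightSwap_unit_middle (S X : C) :
    (ρ_ S).hom ▷ X = rightSwap S (𝟙_ C) X ≫ (ρ_ (S ⊗ X)).hom := by
  simp [rightSwap]

theorem rightSwap_unit_right (S A : C) :
    (ρ_ (S ⊗ A)).hom = rightSwap S A (𝟙_ C) ≫ (ρ_ S).hom ▷ A := by
  simp [rightSwap]

theorem rightSwap_natural_left {S S' : C} (f : S ⟶ S') (A B : C) :
    (f ▷ A) ▷ B ≫ rightSwap S' A B = rightSwap S A B ≫ (f ▷ B) ▷ A := by
  simpa using rightSwap_natural f (𝟙 A) (𝟙 B)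

theorem realizes_blockComm_one (X : C) (s a : ℕ) :
    ∃ h : tpow X (s + a + 1) ⟶ tpow X (s + 1 + a), Realizes X (blockComm s a 1) h ∧
      (tpowAdd X s a).hom ▷ X ≫ h =
        rightSwap (tpow X s) (tpow X a) X ≫ (tpowAdd X (s + 1) a).hom := by
  induction a with
  | zero =>
    refine ⟨𝟙 _, ?_, ?_⟩
    · have := Realizes.refl (X := X) (s + 1)
      rw [← blockComm_zero_left] at this
      exact this
    · exact (Category.comp_id _).trans (rightSwap_unit_middle _ _)
  | succ a ih =>
    obtain ⟨h, H, e⟩ := ih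
    refine ⟨tpowSwap X 0 (s + a + 2) ≫ h ▷ X, ?_, ?_⟩
    · have := Realizes.trans (Realizes.swap (X := X) 0 (s + a + 2)) H.snoc
      rw [show swapPerm 0 (s + a + 2) = blockComm (s + a) 1 1 from rfl] at this
      have e := blockComm_succ_one s a
      exact e ▸ this
    · have aux : ∀ {S A T U : C} (m : S ⊗ A ⟶ T) (m' : (S ⊗ X) ⊗ A ⟶ U) (h : T ⊗ X ⟶ U),
          m ▷ X ≫ h = rightSwap S A X ≫ m' →
          ((α_ S A X).inv ≫ m ▷ X) ▷ X ≫ rightSwap T X X ≫ h ▷ X =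
            rightSwap S (A ⊗ X) X ≫ (α_ (S ⊗ X) A X).inv ≫ m' ▷ X := by
        intro S A T U m m' h e
        rw [← reassoc_of% rightSwap_tensor_middle, ← comp_whiskerRight, ← e, comp_whiskerRight,
          comp_whiskerRight, Category.assoc, ← reassoc_of% rightSwap_natural_left]
      exact aux _ _ _ e

theorem realizes_blockComm (X : C) (s a b : ℕ) :
    ∃ h : tpow X (s + a + b) ⟶ tpow X (s + b + a), Realizes X (blockComm s a b) h ∧
      (tpowAdd X s a).hom ▷ tpow X b ≫ (tpowAdd X (s + a) b).hom ≫ h =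
        rightSwap (tpow X s) (tpow X a) (tpow X b) ≫
          (tpowAdd X s b).hom ▷ tpow X a ≫ (tpowAdd X (s + b) a).hom := by
  induction b with
  | zero =>
    refine ⟨𝟙 _, ?_, ?_⟩
    · have := Realizes.refl (X := X) (s + a)
      rw [← blockComm_zero_right] at this
      exact this
    · have aux : ∀ {S A T : C} (m : S ⊗ A ⟶ T), m ▷ (𝟙_ C) ≫ (ρ_ T).hom ≫ 𝟙 _ =
          rightSwap S A (𝟙_ C) ≫ (ρ_ S).hom ▷ A ≫ m := by
        intro S A T m
        rw [← reassoc_of% rightSwap_unit_right]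
        simp
      exact aux _
  | succ b ih =>
    obtain ⟨h, H, e⟩ := ih
    obtain ⟨h', H', e'⟩ := realizes_blockComm_one X (s + b) a
    refine ⟨h ▷ X ≫ h', ?_, ?_⟩
    · have := Realizes.trans H.snoc H'
      have e := blockComm_succ s a b
      exact e ▸ this
    · have aux : ∀ {S A B T U V W Z : C} (m : S ⊗ A ⟶ T) (n : T ⊗ B ⟶ U) (h : U ⟶ V)
          (k : S ⊗ B ⟶ W) (l : W ⊗ A ⟶ V) (h' : V ⊗ X ⟶ Z) (l' : (W ⊗ X) ⊗ A ⟶ Z),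
          m ▷ B ≫ n ≫ h = rightSwap S A B ≫ k ▷ A ≫ l →
          l ▷ X ≫ h' = rightSwap W A X ≫ l' →
          m ▷ (B ⊗ X) ≫ ((α_ T B X).inv ≫ n ▷ X) ≫ h ▷ X ≫ h' =
            rightSwap S A (B ⊗ X) ≫ ((α_ S B X).inv ≫ k ▷ X) ▷ A ≫ l' := by
        intro S A B T U V W Z m n h k l h' l' e e'
        rw [comp_whiskerRight_assoc, ← reassoc_of% rightSwap_tensor_right,
          ← reassoc_of% rightSwap_natural_left, ← e', ← comp_whiskerRight_assoc,
          ← comp_whiskerRight_assoc,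
          show (rightSwap S A B ≫ k ▷ A) ≫ l = m ▷ B ≫ n ≫ h by rw [Category.assoc, e]]
        simp
      exact aux _ _ _ _ _ _ _ e e'

end Symmetry

/-! ### The Schur functor of an operad -/

section Endomorphisms

variable {C : Type u} [Category.{v} C] [MonoidalCategory C]

/-- A sequence of endomorphisms acting on a tensor product. -/
def tensEndo {F : ℕ → C} (d : ∀ a : ℕ, ℕ → (F a ⟶ F a)) :
    {n : ℕ} → (js k : Vec ℕ n) → (tens F k ⟶ tens F k)
  | _, .nil, .nil => 𝟙 _
  | _, .snoc js j, .snoc k a => tensEndo d js k ⊗ₘ d a j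

theorem tensEndo_self {F : ℕ → C} (d : ∀ a : ℕ, ℕ → (F a ⟶ F a)) (h : ∀ a, d a a = 𝟙 _) :
    ∀ {n : ℕ} (k : Vec ℕ n), tensEndo d k k = 𝟙 _
  | _, .nil => rfl
  | _, .snoc k a => by
    have h' : tensEndo d k k ⊗ₘ d a a = 𝟙 (tens F k ⊗ F a) := by
      rw [tensEndo_self d h k, h, id_tensorHom_id]
    exact h'

theorem tensEndo_toPow {F : ℕ → C} (d d' : ∀ a : ℕ, ℕ → (F a ⟶ F a)) {Q : C}
    (q : ∀ a, F a ⟶ Q) (h : ∀ a j, d a j ≫ q a = d' a j ≫ q a) :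
    ∀ {n : ℕ} (js k : Vec ℕ n),
      tensEndo d js k ≫ tensToPow q k = tensEndo d' js k ≫ tensToPow q k
  | _, .nil, .nil => rfl
  | _, .snoc js j, .snoc k a => by
    have ih := tensEndo_toPow d d' q h js k
    have h' : (tensEndo d js k ⊗ₘ d a j) ≫ (tensToPow q k ⊗ₘ q a) =
        (tensEndo d' js k ⊗ₘ d' a j) ≫ (tensToPow q k ⊗ₘ q a) := by
      rw [tensorHom_comp_tensorHom, tensorHom_comp_tensorHom, ih, h]
    exact h'

end Endomorphisms

section Descent

variable {C : Type u} [Category.{v} C] [MonoidalCategory C] [SymmetricCategory C]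

theorem rightSwap_rightSwap (L A B : C) : rightSwap L A B ≫ rightSwap L B A = 𝟙 _ := by
  simp only [rightSwap, Category.assoc, Iso.inv_hom_id_assoc]
  rw [← whiskerLeft_comp_assoc, SymmetricCategory.symmetry]
  simp

/-- Morphisms out of `L ⊗ Q^{⊗ n}` are described by families of morphisms out of
`L ⊗ F k₁ ⊗ ⋯ ⊗ F kₙ`, if this is so for `n = 1`. -/
theorem tens_desc {F : ℕ → C} {Q : C} (d d' : ∀ a : ℕ, ℕ → (F a ⟶ F a)) (q : ∀ a, F a ⟶ Q)
    (hd : ∀ a, d a a = 𝟙 _) (hd' : ∀ a, d' a a = 𝟙 _) (hq : ∀ a j, d a j ≫ q a = d' a j ≫ q a)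
    (U : ∀ (L Z : C) (ψ : ∀ a, L ⊗ F a ⟶ Z), (∀ a j, L ◁ d a j ≫ ψ a = L ◁ d' a j ≫ ψ a) →
      ∃! m : L ⊗ Q ⟶ Z, ∀ a, L ◁ q a ≫ m = ψ a) :
    ∀ (n : ℕ) (L Z : C) (φ : ∀ k : Vec ℕ n, L ⊗ tens F k ⟶ Z),
      (∀ js k, L ◁ tensEndo d js k ≫ φ k = L ◁ tensEndo d' js k ≫ φ k) →
      ∃! m : L ⊗ tpow Q n ⟶ Z, ∀ k, L ◁ tensToPow q k ≫ m = φ k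
  | 0, L, Z, φ, _ => by
    have key : ∀ m : L ⊗ 𝟙_ C ⟶ Z, L ◁ 𝟙 (𝟙_ C) ≫ m = m := fun m => by simp
    refine ⟨φ .nil, ?_, ?_⟩
    · intro k; cases k; exact key _
    · intro m hm; exact (key m).symm.trans (hm .nil)
  | n + 1, L, Z, φ, hφ => by
    have IH := tens_desc d d' q hd hd' hq U n
    have ext : ∀ {L : C} (f g : L ⊗ tpow Q n ⟶ Z),
        (∀ k, L ◁ tensToPow q k ≫ f = L ◁ tensToPow q k ≫ g) → f = g := by
      intro L f g h
      refine (IH L Z (fun k => L ◁ tensToPow q k ≫ g) ?_).unique h (fun k => rfl)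
      intro js k
      rw [← whiskerLeft_comp_assoc, tensEndo_toPow d d' q hq, whiskerLeft_comp_assoc]
    obtain ⟨φs, hφs⟩ : ∃ φs : ∀ (k : Vec ℕ n) (a : ℕ), L ⊗ (tens F k ⊗ F a) ⟶ Z,
      ∀ k a, φs k a = φ (k.snoc a) := ⟨fun k a => φ (k.snoc a), fun _ _ => rfl⟩
    have hs : ∀ (js k : Vec ℕ n) (j a : ℕ), L ◁ (tensEndo d js k ⊗ₘ d a j) ≫ φs k a =
        L ◁ (tensEndo d' js k ⊗ₘ d' a j) ≫ φs k a := by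
      intro js k j a
      rw [hφs]
      exact hφ (js.snoc j) (k.snoc a)
    let φ' : ∀ (a : ℕ) (k : Vec ℕ n), (L ⊗ F a) ⊗ tens F k ⟶ Z :=
      fun a k => rightSwap L (F a) (tens F k) ≫ (α_ L (tens F k) (F a)).hom ≫ φs k a
    have nat₁ : ∀ {T T' A : C} (e : T ⟶ T'), (L ⊗ A) ◁ e ≫ rightSwap L A T' =
        rightSwap L A T ≫ (L ◁ e) ▷ A := by
      intro T T' A e
      simpa using rightSwap_natural (𝟙 L) (𝟙 A) e
    have nat₂ : ∀ {T A A' : C} (e : A ⟶ A'), (L ◁ e) ▷ T ≫ rightSwap L A' T =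
        rightSwap L A T ≫ (L ⊗ T) ◁ e := by
      intro T A A' e
      simpa using rightSwap_natural (𝟙 L) e (𝟙 T)
    have inv₁ : ∀ (a : ℕ) (js k : Vec ℕ n),
        (L ⊗ F a) ◁ tensEndo d js k ≫ φ' a k = (L ⊗ F a) ◁ tensEndo d' js k ≫ φ' a k := by
      intro a js k
      have h := hs js k a a
      rw [hd, hd', tensorHom_id, tensorHom_id] at h
      simp only [φ']
      rw [reassoc_of% nat₁, reassoc_of% nat₁, associator_naturality_middle_assoc,
        associator_naturality_middle_assoc, h]
    have inv₂ : ∀ (a j : ℕ) (k : Vec ℕ n),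
        (L ◁ d a j) ▷ tens F k ≫ φ' a k = (L ◁ d' a j) ▷ tens F k ≫ φ' a k := by
      intro a j k
      have h := hs k k j a
      rw [tensEndo_self d hd, tensEndo_self d' hd', id_tensorHom, id_tensorHom] at h
      simp only [φ']
      rw [reassoc_of% nat₂, reassoc_of% nat₂, associator_naturality_right_assoc,
        associator_naturality_right_assoc, h]
    choose m hm hm' using fun a => IH (L ⊗ F a) Z (φ' a) (inv₁ a)
    let ψ : ∀ a, (L ⊗ tpow Q n) ⊗ F a ⟶ Z := fun a => rightSwap L (tpow Q n) (F a) ≫ m a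
    have inv₃ : ∀ a j, (L ⊗ tpow Q n) ◁ d a j ≫ ψ a = (L ⊗ tpow Q n) ◁ d' a j ≫ ψ a := by
      intro a j
      have h : (L ◁ d a j) ▷ tpow Q n ≫ m a = (L ◁ d' a j) ▷ tpow Q n ≫ m a := by
        refine ext _ _ fun k => ?_
        rw [whisker_exchange_assoc, whisker_exchange_assoc, hm, inv₂]
      simp only [ψ]
      rw [reassoc_of% nat₁, reassoc_of% nat₁, h]
    obtain ⟨r, hr, hr'⟩ := U (L ⊗ tpow Q n) Z ψ inv₃
    have key : ∀ (a : ℕ) (k : Vec ℕ n) (x : (L ⊗ tpow Q n) ⊗ Q ⟶ Z),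
        L ◁ (tensToPow q k ⊗ₘ q a) ≫ (α_ L (tpow Q n) Q).inv ≫ x =
          (α_ L (tens F k) (F a)).inv ≫ (L ◁ tensToPow q k) ▷ F a ≫
            (L ⊗ tpow Q n) ◁ q a ≫ x := by
      intro a k x
      rw [MonoidalCategory.tensorHom_def, whiskerLeft_comp_assoc,
        associator_inv_naturality_right_assoc, associator_inv_naturality_middle_assoc]
    refine ⟨(α_ L (tpow Q n) Q).inv ≫ r, ?_, ?_⟩
    · intro k
      cases k with
      | snoc k a =>
        refine (key a k r).trans ?_
        rw [hr]
        simp only [ψ]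
        rw [reassoc_of% nat₂, hm]
        simp only [φ']
        rw [reassoc_of% rightSwap_rightSwap, Iso.inv_hom_id_assoc, hφs]
    · intro x₀ hx
      obtain ⟨x, rfl⟩ : ∃ x : L ⊗ (tpow Q n ⊗ Q) ⟶ Z, x = x₀ := ⟨x₀, rfl⟩
      have hx' : (α_ L (tpow Q n) Q).hom ≫ x = r := by
        refine hr' _ fun a => ?_
        have : rightSwap L (F a) (tpow Q n) ≫
            (L ⊗ tpow Q n) ◁ q a ≫ (α_ L (tpow Q n) Q).hom ≫ x = m a := by
          refine hm' a _ fun k => ?_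
          have h := key a k ((α_ L (tpow Q n) Q).hom ≫ x)
          rw [Iso.inv_hom_id_assoc] at h
          have h' := h.symm.trans ((hx (k.snoc a)).trans (hφs k a).symm)
          rw [reassoc_of% nat₁]
          simp only [φ']
          rw [← h', Iso.hom_inv_id_assoc]
        simp only [ψ]
        rw [← this, reassoc_of% rightSwap_rightSwap]
      rw [← hx']
      exact (Iso.inv_hom_id_assoc _ _).symm

end Descent

section Schur

variable {C : Type u} [Category.{v} C] [MonoidalCategory C] [SymmetricCategory C]

section Coinvariants

variable [Preadditive C] [HasCokernels C] [HasCoproducts.{0} C]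

/-- The coinvariants `P n ⊗_{Σₙ} V`, where `t j` is the action on `V` of the adjacent transposition
`swapPerm j n`: the quotient of `P n ⊗ V` by the relations `p s ⊗ x = p ⊗ s x`, for `s` in the
generating set of the adjacent transpositions. -/
def coinv (P : SymmOperad C) (n : ℕ) (V : C) (t : ℕ → (V ⟶ V)) : C :=
  cokernel (Sigma.desc fun j : ℕ => P.act (swapPerm j n) ▷ V - P.obj n ◁ t j)

/-- The quotient morphism. -/
def coinvMk (P : SymmOperad C) (n : ℕ) (V : C) (t : ℕ → (V ⟶ V)) :
    P.obj n ⊗ V ⟶ coinv P n V t :=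
  cokernel.π _

variable (P : SymmOperad C) {n : ℕ} {V W Z : C} {t : ℕ → (V ⟶ V)} {t' : ℕ → (W ⟶ W)}

theorem coinv_condition (j : ℕ) :
    P.act (swapPerm j n) ▷ V ≫ coinvMk P n V t = P.obj n ◁ t j ≫ coinvMk P n V t := by
  have h := cokernel.condition (Sigma.desc fun j : ℕ => P.act (swapPerm j n) ▷ V - P.obj n ◁ t j)
  have h' := Sigma.ι (fun _ : ℕ => P.obj n ⊗ V) j ≫= h
  rw [Sigma.ι_desc_assoc, comp_zero, Preadditive.sub_comp, sub_eq_zero] at h'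
  exact h'

/-- The universal property of the coinvariants. -/
def coinvDesc (f : P.obj n ⊗ V ⟶ Z)
    (h : ∀ j, P.act (swapPerm j n) ▷ V ≫ f = P.obj n ◁ t j ≫ f) : coinv P n V t ⟶ Z :=
  cokernel.desc _ f (by
    ext j
    rw [Sigma.ι_desc_assoc, comp_zero, Preadditive.sub_comp, h, sub_self])

theorem coinvMk_desc (f : P.obj n ⊗ V ⟶ Z)
    (h : ∀ j, P.act (swapPerm j n) ▷ V ≫ f = P.obj n ◁ t j ≫ f) :
    coinvMk P n V t ≫ coinvDesc P f h = f :=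
  cokernel.π_desc _ _ _

theorem coinvMk_desc_assoc (f : P.obj n ⊗ V ⟶ Z)
    (h : ∀ j, P.act (swapPerm j n) ▷ V ≫ f = P.obj n ◁ t j ≫ f) {Y : C} (g : Z ⟶ Y) :
    coinvMk P n V t ≫ coinvDesc P f h ≫ g = f ≫ g := by
  rw [← Category.assoc, coinvMk_desc]

theorem coinv_hom_ext {f g : coinv P n V t ⟶ Z}
    (h : coinvMk P n V t ≫ f = coinvMk P n V t ≫ g) : f = g :=
  coequalizer.hom_ext h

/-- The morphism on coinvariants induced by an equivariant morphism. -/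
def coinvMap (φ : V ⟶ W) (h : ∀ j, φ ≫ t' j = t j ≫ φ) : coinv P n V t ⟶ coinv P n W t' :=
  coinvDesc P (P.obj n ◁ φ ≫ coinvMk P n W t') (by
    intro j
    rw [← whisker_exchange_assoc, coinv_condition, ← whiskerLeft_comp_assoc, h,
      whiskerLeft_comp_assoc])

theorem coinvMk_map (φ : V ⟶ W) (h : ∀ j, φ ≫ t' j = t j ≫ φ) :
    coinvMk P n V t ≫ coinvMap P φ h = P.obj n ◁ φ ≫ coinvMk P n W t' :=
  coinvMk_desc _ _ _

theorem coinvMk_map_assoc (φ : V ⟶ W) (h : ∀ j, φ ≫ t' j = t j ≫ φ) {Y : C}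
    (g : coinv P n W t' ⟶ Y) :
    coinvMk P n V t ≫ coinvMap P φ h ≫ g = P.obj n ◁ φ ≫ coinvMk P n W t' ≫ g := by
  rw [← Category.assoc, coinvMk_map, Category.assoc]

/-- The Schur functor `P(X) = ⨁ₙ P n ⊗_{Σₙ} X^{⊗ n}`. -/
def schur (X : C) : C :=
  ∐ fun n : ℕ => coinv P n (tpow X n) (fun j => tpowSwap X j n)

/-- The inclusion of the `n`-th summand. -/
def schurIn (X : C) (n : ℕ) : coinv P n (tpow X n) (fun j => tpowSwap X j n) ⟶ schur P X :=
  Sigma.ι (fun n : ℕ => coinv P n (tpow X n) (fun j => tpowSwap X j n)) n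

/-- The canonical morphism `P n ⊗ X^{⊗ n} → P(X)`. -/
def schurι (X : C) (n : ℕ) : P.obj n ⊗ tpow X n ⟶ schur P X :=
  coinvMk P n (tpow X n) (fun j => tpowSwap X j n) ≫ schurIn P X n

/-- Functoriality of the Schur functor. -/
def schurMap {X Y : C} (f : X ⟶ Y) : schur P X ⟶ schur P Y :=
  Limits.Sigma.map fun n : ℕ => coinvMap P (tpowMap f n) (fun j => tpowSwap_natural f j n)

theorem schurι_condition (X : C) (n j : ℕ) :
    P.act (swapPerm j n) ▷ tpow X n ≫ schurι P X n =
      P.obj n ◁ tpowSwap X j n ≫ schurι P X n := by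
  simp only [schurι]
  exact (reassoc_of% coinv_condition P j) (schurIn P X n)

theorem schurι_realizes {X : C} {m n : ℕ} {e : Fin m ≃ Fin n} {h : tpow X m ⟶ tpow X n}
    (H : Realizes X e h) :
    P.act e ▷ tpow X m ≫ schurι P X m = P.obj n ◁ h ≫ schurι P X n := by
  induction H with
  | refl n => simp [P.act_refl]
  | trans H K ih ih' =>
    rw [P.act_trans, comp_whiskerRight_assoc, ih, ← whisker_exchange_assoc, ih',
      whiskerLeft_comp_assoc]
  | swap j n => exact schurι_condition P X n j

/-- The universal property of the Schur functor. -/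
def schurDesc {X : C} (f : ∀ n, P.obj n ⊗ tpow X n ⟶ Z)
    (h : ∀ n j, P.act (swapPerm j n) ▷ tpow X n ≫ f n = P.obj n ◁ tpowSwap X j n ≫ f n) :
    schur P X ⟶ Z :=
  Sigma.desc fun n => coinvDesc P (f n) (h n)

theorem schurι_desc {X : C} (f : ∀ n, P.obj n ⊗ tpow X n ⟶ Z)
    (h : ∀ n j, P.act (swapPerm j n) ▷ tpow X n ≫ f n = P.obj n ◁ tpowSwap X j n ≫ f n) (n : ℕ) :
    schurι P X n ≫ schurDesc P f h = f n := by
  have h' : schurIn P X n ≫ schurDesc P f h = coinvDesc P (f n) (h n) := Sigma.ι_desc _ _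
  rw [schurι, Category.assoc, h', coinvMk_desc]

theorem schur_hom_ext {X : C} {f g : schur P X ⟶ Z}
    (h : ∀ n, schurι P X n ≫ f = schurι P X n ≫ g) : f = g := by
  refine Sigma.hom_ext _ _ fun n => coinv_hom_ext P ?_
  have := h n
  rw [schurι, Category.assoc, Category.assoc] at this
  exact this

end Coinvariants

/-! ### The multiplication of the Schur functor -/

section Multiplication

/-- The sequence of the adjacent transpositions `swapPerm jᵢ kᵢ`. -/
def swapEquiv : {n : ℕ} → (js k : Vec ℕ n) → VecEquiv k k
  | _, .nil, .nil => .nil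
  | _, .snoc js j, .snoc k a => .snoc (swapEquiv js k) (swapPerm j a)

variable (P : SymmOperad C)

theorem tensEndo_act_unzip (X : C) : ∀ {n : ℕ} (js k : Vec ℕ n),
    tensEndo (F := fun a => P.obj a ⊗ tpow X a)
        (fun a j => P.act (swapPerm j a) ▷ tpow X a) js k ≫ unzipPow P.obj X k =
      unzipPow P.obj X k ≫ tensAct P.act (swapEquiv js k) ▷ tpow X k.sum
  | _, .nil, .nil => by
    refine (Category.id_comp _).trans ?_
    refine (Category.comp_id _).symm.trans ?_
    exact congrArg _ (id_whiskerRight _ _).symm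
  | _, .snoc js j, .snoc k a => by
    have ih := tensEndo_act_unzip X js k
    have aux : ∀ {T U V Q A D : C} (e : T ⟶ T) (z : T ⟶ U ⊗ V) (f : U ⟶ U) (p : Q ⟶ Q)
        (m : V ⊗ A ⟶ D), e ≫ z = z ≫ f ▷ V →
        (e ⊗ₘ (p ▷ A)) ≫ z ▷ (Q ⊗ A) ≫ tensorμ U V Q A ≫ (U ⊗ Q) ◁ m =
          (z ▷ (Q ⊗ A) ≫ tensorμ U V Q A ≫ (U ⊗ Q) ◁ m) ≫ (f ⊗ₘ p) ▷ D := by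
      intro T U V Q A D e z f p m h
      have nat := tensorμ_natural f (𝟙 V) p (𝟙 A)
      simp only [tensorHom_id, id_whiskerRight] at nat
      rw [tensorHom_comp_whiskerRight_assoc, h]
      simp only [Category.assoc]
      rw [whisker_exchange, ← reassoc_of% nat, whiskerRight_comp_tensorHom_assoc]
    exact aux _ _ _ _ _ ih

theorem tensEndo_swap_unzip (X : C) : ∀ {n : ℕ} (js k : Vec ℕ n),
    ∃ g, Realizes X (swapEquiv js k).sum g ∧
      tensEndo (F := fun a => P.obj a ⊗ tpow X a)
          (fun a j => P.obj a ◁ tpowSwap X j a) js k ≫ unzipPow P.obj X k =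
        unzipPow P.obj X k ≫ tens P.obj k ◁ g
  | _, .nil, .nil => by
    refine ⟨𝟙 _, Realizes.refl 0, ?_⟩
    refine (Category.id_comp _).trans ?_
    refine (Category.comp_id _).symm.trans ?_
    exact congrArg _ (whiskerLeft_id _ _).symm
  | _, .snoc js j, .snoc k a => by
    obtain ⟨g, hg, ih⟩ := tensEndo_swap_unzip X js k
    obtain ⟨g₁, h₁, e₁⟩ := hg.blockSum_left a
    obtain ⟨g₂, h₂, e₂⟩ := Realizes.blockSum_right X k.sum j a
    refine ⟨g₁ ≫ g₂, ?_, ?_⟩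
    · have := h₁.trans h₂
      rw [← blockSum_trans] at this
      exact this
    · have aux : ∀ {T U V Q A D : C} (e : T ⟶ T) (z : T ⟶ U ⊗ V) (f : V ⟶ V) (p : A ⟶ A)
          (m : V ⊗ A ⟶ D) (g₁ g₂ : D ⟶ D), e ≫ z = z ≫ U ◁ f → f ▷ A ≫ m = m ≫ g₁ →
          V ◁ p ≫ m = m ≫ g₂ →
          (e ⊗ₘ (Q ◁ p)) ≫ z ▷ (Q ⊗ A) ≫ tensorμ U V Q A ≫ (U ⊗ Q) ◁ m =
            (z ▷ (Q ⊗ A) ≫ tensorμ U V Q A ≫ (U ⊗ Q) ◁ m) ≫ (U ⊗ Q) ◁ (g₁ ≫ g₂) := by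
        intro T U V Q A D e z f p m g₁ g₂ h h₁ h₂
        have nat := tensorμ_natural (𝟙 U) f (𝟙 Q) p
        simp only [id_tensorHom, whiskerLeft_id] at nat
        rw [tensorHom_comp_whiskerRight_assoc, h]
        simp only [Category.assoc]
        rw [← whiskerLeft_comp, ← reassoc_of% h₁, ← h₂, ← MonoidalCategory.tensorHom_def_assoc,
          whiskerLeft_comp, ← reassoc_of% nat, whiskerRight_comp_tensorHom_assoc]
      exact aux _ _ _ _ _ _ _ ih e₁ e₂

theorem tensSwapLast_unzip (X : C) : ∀ {n : ℕ} (k : Vec ℕ n),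
    ∃ g, Realizes X (blockSwapLast k) g ∧
      tensSwapLast (fun a => P.obj a ⊗ tpow X a) k ≫ unzipPow P.obj X k.swapLast =
        unzipPow P.obj X k ≫ (tensSwapLast P.obj k ⊗ₘ g)
  | _, .nil => ⟨𝟙 _, Realizes.refl 0, by
      refine (Category.id_comp _).trans ?_
      refine (Category.comp_id _).symm.trans ?_
      exact congrArg _ (id_tensorHom_id _ _).symm⟩
  | _, .snoc .nil a => ⟨𝟙 _, Realizes.refl _, by
      refine (Category.id_comp _).trans ?_
      refine (Category.comp_id _).symm.trans ?_
      exact congrArg _ (id_tensorHom_id _ _).symm⟩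
  | _, .snoc (.snoc k a) b => by
    obtain ⟨g, hg, e⟩ := realizes_blockComm X k.sum a b
    refine ⟨g, hg, ?_⟩
    have aux : ∀ {T U V A₁ A₂ B₁ B₂ W Z W' Z' : C} (z : T ⟶ U ⊗ V) (m : V ⊗ A₂ ⟶ W)
        (n : W ⊗ B₂ ⟶ Z) (m' : V ⊗ B₂ ⟶ W') (n' : W' ⊗ A₂ ⟶ Z') (g : Z ⟶ Z'),
        m ▷ B₂ ≫ n ≫ g = rightSwap V A₂ B₂ ≫ m' ▷ A₂ ≫ n' →
        rightSwap T (A₁ ⊗ A₂) (B₁ ⊗ B₂) ≫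
          ((z ▷ (B₁ ⊗ B₂) ≫ tensorμ U V B₁ B₂ ≫ (U ⊗ B₁) ◁ m') ▷ (A₁ ⊗ A₂) ≫
            tensorμ (U ⊗ B₁) W' A₁ A₂ ≫ ((U ⊗ B₁) ⊗ A₁) ◁ n') =
        ((z ▷ (A₁ ⊗ A₂) ≫ tensorμ U V A₁ A₂ ≫ (U ⊗ A₁) ◁ m) ▷ (B₁ ⊗ B₂) ≫
            tensorμ (U ⊗ A₁) W B₁ B₂ ≫ ((U ⊗ A₁) ⊗ B₁) ◁ n) ≫ (rightSwap U A₁ B₁ ⊗ₘ g) := by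
      intro T U V A₁ A₂ B₁ B₂ W Z W' Z' z m n m' n' g h
      have nat : ∀ {U V W Q A : C} (m : V ⟶ W), (U ◁ m) ▷ (Q ⊗ A) ≫ tensorμ U W Q A =
          tensorμ U V Q A ≫ (U ⊗ Q) ◁ (m ▷ A) := by
        intro U V W Q A m
        have := tensorμ_natural (𝟙 U) m (𝟙 Q) (𝟙 A)
        simpa only [id_tensorHom, whiskerLeft_id, tensorHom_id, id_whiskerRight] using this
      simp only [comp_whiskerRight, Category.assoc]
      rw [reassoc_of% nat, reassoc_of% nat, ← reassoc_of% rightSwap_natural_left]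
      have K := tensorμ_rightSwap U V A₁ A₂ B₁ B₂
      rw [reassoc_of% K]
      simp only [← whiskerLeft_comp_assoc, ← whiskerLeft_comp]
      rw [whiskerLeft_comp_tensorHom, tensorHom_comp_whiskerLeft, Category.assoc, h]
    exact aux _ _ _ _ _ _ e

theorem tensSwap_unzip (X : C) : ∀ (j : ℕ) {n : ℕ} (k : Vec ℕ n),
    ∃ g, Realizes X (blockSwap j k) g ∧
      tensSwap (fun a => P.obj a ⊗ tpow X a) j k ≫ unzipPow P.obj X (k.swapAt j) =
        unzipPow P.obj X k ≫ (tensSwap P.obj j k ⊗ₘ g)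
  | 0, _, k => tensSwapLast_unzip P X k
  | _ + 1, _, .nil => ⟨𝟙 _, Realizes.refl 0, by
      refine (Category.id_comp _).trans ?_
      refine (Category.comp_id _).symm.trans ?_
      exact congrArg _ (id_tensorHom_id _ _).symm⟩
  | j + 1, _, .snoc k a => by
    obtain ⟨g, hg, ih⟩ := tensSwap_unzip X j k
    obtain ⟨g₁, h₁, e₁⟩ := hg.blockSum_left a
    refine ⟨g₁, h₁, ?_⟩
    have aux : ∀ {T T' U V U' V' Q A D D' : C} (e : T ⟶ T') (z : T ⟶ U ⊗ V) (z' : T' ⟶ U' ⊗ V')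
        (f : U ⟶ U') (g : V ⟶ V') (m : V ⊗ A ⟶ D) (m' : V' ⊗ A ⟶ D') (g₁ : D ⟶ D'),
        e ≫ z' = z ≫ (f ⊗ₘ g) → g ▷ A ≫ m' = m ≫ g₁ →
        e ▷ (Q ⊗ A) ≫ z' ▷ (Q ⊗ A) ≫ tensorμ U' V' Q A ≫ (U' ⊗ Q) ◁ m' =
          (z ▷ (Q ⊗ A) ≫ tensorμ U V Q A ≫ (U ⊗ Q) ◁ m) ≫ ((f ▷ Q) ⊗ₘ g₁) := by
      intro T T' U V U' V' Q A D D' e z z' f g m m' g₁ h h₁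
      rw [← comp_whiskerRight_assoc, h, comp_whiskerRight_assoc, tensorμ_natural_left_assoc,
        tensorHom_comp_whiskerLeft, h₁]
      simp only [Category.assoc]
      rw [whiskerLeft_comp_tensorHom]
    exact aux _ _ _ _ _ _ _ _ ih e₁

/-- The morphism `P n ⊗ ⨂ᵢ (P kᵢ ⊗ X^{⊗ kᵢ}) → P (k₁ + ⋯ + kₙ) ⊗ X^{⊗ (k₁ + ⋯ + kₙ)}` given by
the symmetry and the composition of the operad. -/
def opComp (X : C) {n : ℕ} (k : Vec ℕ n) :
    P.obj n ⊗ tens (fun a => P.obj a ⊗ tpow X a) k ⟶ P.obj k.sum ⊗ tpow X k.sum :=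
  P.obj n ◁ unzipPow P.obj X k ≫ (α_ _ _ _).inv ≫ P.comp k ▷ tpow X k.sum

variable [Preadditive C] [HasCokernels C] [HasCoproducts.{0} C]

theorem opComp_inner (X : C) {n : ℕ} (js k : Vec ℕ n) :
    P.obj n ◁ tensEndo (F := fun a => P.obj a ⊗ tpow X a)
        (fun a j => P.act (swapPerm j a) ▷ tpow X a) js k ≫ opComp P X k ≫ schurι P X k.sum =
      P.obj n ◁ tensEndo (F := fun a => P.obj a ⊗ tpow X a)
        (fun a j => P.obj a ◁ tpowSwap X j a) js k ≫ opComp P X k ≫ schurι P X k.sum := by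
  obtain ⟨g, hg, e⟩ := tensEndo_swap_unzip P X js k
  have h := P.comp_act_inner (swapEquiv js k)
  simp only [opComp, Category.assoc]
  rw [← whiskerLeft_comp_assoc, ← whiskerLeft_comp_assoc, e, tensEndo_act_unzip,
    whiskerLeft_comp_assoc, whiskerLeft_comp_assoc, associator_inv_naturality_middle_assoc,
    associator_inv_naturality_right_assoc, ← comp_whiskerRight_assoc, h, comp_whiskerRight_assoc,
    schurι_realizes P hg, whisker_exchange_assoc]

theorem opComp_outer (X : C) {n : ℕ} (j : ℕ) (k : Vec ℕ n) :
    P.act (swapPerm j n) ▷ _ ≫ opComp P X k ≫ schurι P X k.sum =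
      P.obj n ◁ tensSwap (fun a => P.obj a ⊗ tpow X a) j k ≫
        opComp P X (k.swapAt j) ≫ schurι P X (k.swapAt j).sum := by
  obtain ⟨g, hg, e⟩ := tensSwap_unzip P X j k
  have h := P.comp_act_outer j k
  simp only [opComp, Category.assoc]
  rw [← whiskerLeft_comp_assoc, e, whiskerLeft_comp_assoc, MonoidalCategory.tensorHom_def,
    whiskerLeft_comp_assoc, associator_inv_naturality_right_assoc,
    associator_inv_naturality_middle_assoc, ← whisker_exchange_assoc,
    associator_inv_naturality_left_assoc, ← comp_whiskerRight_assoc, h]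
  simp only [comp_whiskerRight, Category.assoc]
  rw [schurι_realizes P hg, whisker_exchange_assoc]


variable [MonoidalClosed C]

theorem schur_tensor_desc (X L Z : C) (ψ : ∀ a, L ⊗ (P.obj a ⊗ tpow X a) ⟶ Z)
    (h : ∀ a j, L ◁ (P.act (swapPerm j a) ▷ tpow X a) ≫ ψ a =
      L ◁ (P.obj a ◁ tpowSwap X j a) ≫ ψ a) :
    ∃! m : L ⊗ schur P X ⟶ Z, ∀ a, L ◁ schurι P X a ≫ m = ψ a := by
  refine ⟨MonoidalClosed.uncurry (schurDesc P (fun a => MonoidalClosed.curry (ψ a)) ?_), ?_, ?_⟩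
  · intro a j
    rw [← MonoidalClosed.curry_natural_left, h, MonoidalClosed.curry_natural_left]
  · intro a
    rw [← MonoidalClosed.uncurry_natural_left, schurι_desc, MonoidalClosed.uncurry_curry]
  · intro m hm
    rw [← MonoidalClosed.curry_eq_iff]
    refine schur_hom_ext P fun a => ?_
    rw [← MonoidalClosed.curry_natural_left, hm, schurι_desc]

/-- Morphisms out of `L ⊗ P(X)^{⊗ n}` are described by families of morphisms out of
`L ⊗ ⨂ᵢ (P kᵢ ⊗ X^{⊗ kᵢ})`. -/
theorem schur_pow_desc (X L Z : C) {n : ℕ}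
    (φ : ∀ k : Vec ℕ n, L ⊗ tens (fun a => P.obj a ⊗ tpow X a) k ⟶ Z)
    (h : ∀ js k : Vec ℕ n, L ◁ tensEndo (F := fun a => P.obj a ⊗ tpow X a)
        (fun a j => P.act (swapPerm j a) ▷ tpow X a) js k ≫ φ k =
      L ◁ tensEndo (F := fun a => P.obj a ⊗ tpow X a)
        (fun a j => P.obj a ◁ tpowSwap X j a) js k ≫ φ k) :
    ∃! m : L ⊗ tpow (schur P X) n ⟶ Z, ∀ k, L ◁ tensToPow (schurι P X) k ≫ m = φ k := by
  refine tens_desc (F := fun a => P.obj a ⊗ tpow X a) _ _ (schurι P X) ?_ ?_ ?_ ?_ n L Z φ h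
  · intro a
    simp only [swapPerm_eq_refl a a (by omega), P.act_refl, id_whiskerRight]
  · intro a
    simp only [tpowSwap_eq_id X a a (by omega), whiskerLeft_id]
  · intro a j
    exact schurι_condition P X a j
  · intro L Z ψ hψ
    exact schur_tensor_desc P X L Z ψ hψ

theorem schur_pow_hom_ext {X L Z : C} {n : ℕ} {f g : L ⊗ tpow (schur P X) n ⟶ Z}
    (h : ∀ k : Vec ℕ n, L ◁ tensToPow (schurι P X) k ≫ f = L ◁ tensToPow (schurι P X) k ≫ g) :
    f = g := by
  refine (schur_pow_desc P X L Z (fun k => L ◁ tensToPow (schurι P X) k ≫ g) ?_).unique h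
    (fun k => rfl)
  intro js k
  rw [← whiskerLeft_comp_assoc, tensEndo_toPow _ _ _ (fun a j => schurι_condition P X a j),
    whiskerLeft_comp_assoc]

/-- The multiplication on the summand `P n ⊗ P(X)^{⊗ n}`: the unique morphism that is given on
`P n ⊗ ⨂ᵢ (P kᵢ ⊗ X^{⊗ kᵢ})` by the composition of the operad. -/
theorem schurMulAux_existsUnique (X : C) (n : ℕ) :
    ∃! m : P.obj n ⊗ tpow (schur P X) n ⟶ schur P X, ∀ k : Vec ℕ n,
      P.obj n ◁ tensToPow (schurι P X) k ≫ m = opComp P X k ≫ schurι P X k.sum :=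
  schur_pow_desc P X _ _ _ fun js k => opComp_inner P X js k

/-- The multiplication on the summand `P n ⊗ P(X)^{⊗ n}`. -/
def schurMulAux (X : C) (n : ℕ) : P.obj n ⊗ tpow (schur P X) n ⟶ schur P X :=
  (schurMulAux_existsUnique P X n).choose

theorem schurMulAux_spec (X : C) {n : ℕ} (k : Vec ℕ n) :
    P.obj n ◁ tensToPow (schurι P X) k ≫ schurMulAux P X n = opComp P X k ≫ schurι P X k.sum :=
  (schurMulAux_existsUnique P X n).choose_spec.1 k

/-- The multiplication `μ : P(P(X)) → P(X)` of the Schur functor, induced by the composition of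
the operad. -/
def schurMul (X : C) : schur P (schur P X) ⟶ schur P X :=
  schurDesc P (schurMulAux P X) (by
    intro n j
    refine schur_pow_hom_ext P fun k => ?_
    rw [whisker_exchange_assoc, schurMulAux_spec, opComp_outer, ← whiskerLeft_comp_assoc,
      tensToPow_swap, whiskerLeft_comp_assoc, schurMulAux_spec])

/-- The multiplication is characterized by the composition of the operad. -/
theorem schurMul_spec (X : C) {n : ℕ} (k : Vec ℕ n) :
    P.obj n ◁ tensToPow (schurι P X) k ≫ schurι P (schur P X) n ≫ schurMul P X =
      opComp P X k ≫ schurι P X k.sum := by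
  rw [schurMul, schurι_desc, schurMulAux_spec]

/-- The unit `X → P(X)` of the Schur functor, induced by the unit of the operad. -/
def schurOne (X : C) : X ⟶ schur P X :=
  (λ_ X).inv ≫ (P.one ⊗ₘ (λ_ X).inv) ≫ schurι P X 1

end Multiplication

end Schur

/-! ### The object `P ∘ (B|X)` -/

section RelPow

variable {C : Type u} [Category.{v} C] [Abelian C] [MonoidalCategory C]

theorem whiskerLeft_zero_of_closed [MonoidalClosed C] (L V W : C) : L ◁ (0 : V ⟶ W) = 0 := by
  apply MonoidalClosed.curry_injective
  have h : ∀ Z : C, MonoidalClosed.curry (L ◁ (0 : V ⟶ W) ≫ (0 : L ⊗ W ⟶ Z)) = 0 := fun Z => by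
    rw [MonoidalClosed.curry_natural_left, zero_comp]
  have h' := h (L ⊗ W)
  rw [comp_zero] at h'
  rw [h', ← Category.comp_id (L ◁ (0 : V ⟶ W)), MonoidalClosed.curry_natural_left, zero_comp]

/-- The quotient `(X ⊕ B)^{⊗ n} / B^{⊗ n}`. -/
def relPow (B X : C) (n : ℕ) : C :=
  cokernel (tpowMap (biprod.inr : B ⟶ X ⊞ B) n)

/-- The quotient morphism `(X ⊕ B)^{⊗ n} → (X ⊕ B)^{⊗ n} / B^{⊗ n}`. -/
def relPowProj (B X : C) (n : ℕ) : tpow (X ⊞ B) n ⟶ relPow B X n :=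
  cokernel.π _

theorem relPow_hom_ext {B X Z : C} {n : ℕ} {f g : relPow B X n ⟶ Z}
    (h : relPowProj B X n ≫ f = relPowProj B X n ≫ g) : f = g :=
  coequalizer.hom_ext h

/-- Functoriality of `(X ⊕ B)^{⊗ n} / B^{⊗ n}`. -/
def relPowMap {B B' X X' : C} (g : B ⟶ B') (f : X ⟶ X') (n : ℕ) :
    relPow B X n ⟶ relPow B' X' n :=
  cokernel.map _ _ (tpowMap g n) (tpowMap (biprod.map f g) n) (by
    rw [← tpowMap_comp, ← tpowMap_comp, biprod.inr_map])

theorem relPowProj_map {B B' X X' : C} (g : B ⟶ B') (f : X ⟶ X') (n : ℕ) :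
    relPowProj B X n ≫ relPowMap g f n = tpowMap (biprod.map f g) n ≫ relPowProj B' X' n :=
  cokernel.π_desc _ _ _

theorem relPowMap_id (B X : C) (n : ℕ) : relPowMap (𝟙 B) (𝟙 X) n = 𝟙 _ := by
  have h : biprod.map (𝟙 X) (𝟙 B) = 𝟙 (X ⊞ B) := by ext <;> simp
  refine relPow_hom_ext ?_
  rw [relPowProj_map, h, tpowMap_id, Category.id_comp, Category.comp_id]

theorem relPowMap_comp {B B' B'' X X' X'' : C} (g : B ⟶ B') (g' : B' ⟶ B'') (f : X ⟶ X')
    (f' : X' ⟶ X'') (n : ℕ) :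
    relPowMap (g ≫ g') (f ≫ f') n = relPowMap g f n ≫ relPowMap g' f' n := by
  have h : biprod.map (f ≫ f') (g ≫ g') = biprod.map f g ≫ biprod.map f' g' := by ext <;> simp
  refine relPow_hom_ext ?_
  rw [relPowProj_map, h, tpowMap_comp, ← Category.assoc, relPowProj_map, Category.assoc,
    Category.assoc, relPowProj_map]

/-- The inclusion of `(X ⊕ B)^{⊗ n} / B^{⊗ n}` into `(X ⊕ B)^{⊗ n}` as the complement of
`B^{⊗ n}`, i.e. as the kernel of the projection to `B^{⊗ n}`. -/
def relPowIncl (B X : C) (n : ℕ) : relPow B X n ⟶ tpow (X ⊞ B) n :=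
  cokernel.desc _ (𝟙 _ - tpowMap (biprod.snd ≫ biprod.inr) n) (by
    rw [Preadditive.comp_sub, ← tpowMap_comp, biprod.inr_snd_assoc, Category.comp_id, sub_self])

theorem relPowProj_incl (B X : C) (n : ℕ) :
    relPowProj B X n ≫ relPowIncl B X n = 𝟙 _ - tpowMap (biprod.snd ≫ biprod.inr) n :=
  cokernel.π_desc _ _ _

theorem relPowIncl_natural {B B' X X' : C} (g : B ⟶ B') (f : X ⟶ X') (n : ℕ) :
    relPowMap g f n ≫ relPowIncl B' X' n = relPowIncl B X n ≫ tpowMap (biprod.map f g) n := by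
  refine relPow_hom_ext ?_
  rw [← Category.assoc, relPowProj_map, Category.assoc, relPowProj_incl, ← Category.assoc,
    relPowProj_incl, Preadditive.sub_comp, Preadditive.comp_sub, ← tpowMap_comp, ← tpowMap_comp,
    Category.comp_id, Category.id_comp, biprod.map_snd_assoc, Category.assoc, biprod.inr_map]

theorem relPowIncl_snd (B X : C) (n : ℕ) :
    relPowIncl B X n ≫ tpowMap (biprod.snd : X ⊞ B ⟶ B) n = 0 := by
  refine relPow_hom_ext ?_
  rw [← Category.assoc, relPowProj_incl, Preadditive.sub_comp, ← tpowMap_comp, Category.assoc,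
    biprod.inr_snd, Category.comp_id, Category.id_comp, sub_self, comp_zero]

variable [SymmetricCategory C]

/-- The action of the adjacent transposition `swapPerm j n` on `(X ⊕ B)^{⊗ n} / B^{⊗ n}`. -/
def relPowSwap (B X : C) (n j : ℕ) : relPow B X n ⟶ relPow B X n :=
  cokernel.map _ _ (tpowSwap B j n) (tpowSwap (X ⊞ B) j n) (tpowSwap_natural _ j n)

theorem relPowProj_swap (B X : C) (n j : ℕ) :
    relPowProj B X n ≫ relPowSwap B X n j = tpowSwap (X ⊞ B) j n ≫ relPowProj B X n :=
  cokernel.π_desc _ _ _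

theorem relPowMap_swap {B B' X X' : C} (g : B ⟶ B') (f : X ⟶ X') (n j : ℕ) :
    relPowMap g f n ≫ relPowSwap B' X' n j = relPowSwap B X n j ≫ relPowMap g f n := by
  refine relPow_hom_ext ?_
  rw [← Category.assoc, relPowProj_map, Category.assoc, relPowProj_swap, ← Category.assoc,
    tpowSwap_natural, Category.assoc, ← Category.assoc (relPowProj B X n), relPowProj_swap,
    Category.assoc, relPowProj_map]

theorem relPowIncl_swap (B X : C) (n j : ℕ) :
    relPowIncl B X n ≫ tpowSwap (X ⊞ B) j n = relPowSwap B X n j ≫ relPowIncl B X n := by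
  refine relPow_hom_ext ?_
  rw [← Category.assoc, relPowProj_incl, ← Category.assoc, relPowProj_swap, Category.assoc,
    relPowProj_incl, Preadditive.sub_comp, Preadditive.comp_sub, tpowSwap_natural,
    Category.id_comp, Category.comp_id]

end RelPow

section Algebras

variable {C : Type u} [Category.{v} C] [Abelian C] [HasCoproducts.{0} C] [MonoidalCategory C]
  [SymmetricCategory C] (P : SymmOperad C)

theorem schurIn_map {X Y : C} (f : X ⟶ Y) (n : ℕ) :
    schurIn P X n ≫ schurMap P f =
      coinvMap P (tpowMap f n) (fun j => tpowSwap_natural f j n) ≫ schurIn P Y n :=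
  Sigma.ι_map _ _

theorem schurι_map {X Y : C} (f : X ⟶ Y) (n : ℕ) :
    schurι P X n ≫ schurMap P f = P.obj n ◁ tpowMap f n ≫ schurι P Y n := by
  rw [schurι, Category.assoc, schurIn_map, coinvMk_map_assoc, schurι]

theorem schurMap_id (X : C) : schurMap P (𝟙 X) = 𝟙 _ := by
  refine schur_hom_ext P fun n => ?_
  rw [schurι_map, tpowMap_id, whiskerLeft_id, Category.id_comp, Category.comp_id]

theorem schurMap_comp {X Y Z : C} (f : X ⟶ Y) (g : Y ⟶ Z) :
    schurMap P (f ≫ g) = schurMap P f ≫ schurMap P g := by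
  refine schur_hom_ext P fun n => ?_
  rw [schurι_map, tpowMap_comp, whiskerLeft_comp_assoc, ← Category.assoc (schurι P X n),
    schurι_map, Category.assoc, schurι_map]

/-- `P ∘ (B|X) = ⨁ₙ P n ⊗_{Σₙ} ((X ⊕ B)^{⊗ n} / B^{⊗ n})`. -/
def schurRel (B X : C) : C :=
  ∐ fun n : ℕ => coinv P n (relPow B X n) (relPowSwap B X n)

/-- The inclusion of the `n`-th summand. -/
def schurRelIn (B X : C) (n : ℕ) : coinv P n (relPow B X n) (relPowSwap B X n) ⟶ schurRel P B X :=
  Sigma.ι (fun n : ℕ => coinv P n (relPow B X n) (relPowSwap B X n)) n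

/-- The canonical morphism `P n ⊗ ((X ⊕ B)^{⊗ n} / B^{⊗ n}) → P ∘ (B|X)`. -/
def schurRelι (B X : C) (n : ℕ) : P.obj n ⊗ relPow B X n ⟶ schurRel P B X :=
  coinvMk P n (relPow B X n) (relPowSwap B X n) ≫ schurRelIn P B X n

theorem schurRel_hom_ext {B X Z : C} {f g : schurRel P B X ⟶ Z}
    (h : ∀ n, schurRelι P B X n ≫ f = schurRelι P B X n ≫ g) : f = g := by
  refine Sigma.hom_ext _ _ fun n => coinv_hom_ext P ?_
  have := h n
  rw [schurRelι, Category.assoc, Category.assoc] at this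
  exact this

/-- Functoriality of `P ∘ (B|X)`: the morphism `P ∘ (g|f)`. -/
def schurRelMap {B B' X X' : C} (g : B ⟶ B') (f : X ⟶ X') : schurRel P B X ⟶ schurRel P B' X' :=
  Limits.Sigma.map fun n : ℕ => coinvMap P (relPowMap g f n) (relPowMap_swap g f n)

/-- The projection `P(X ⊕ B) → P ∘ (B|X)`. -/
def relProj (B X : C) : schur P (X ⊞ B) ⟶ schurRel P B X :=
  Limits.Sigma.map fun n : ℕ => coinvMap P (relPowProj B X n) (relPowProj_swap B X n)

/-- The inclusion `P ∘ (B|X) → P(X ⊕ B)` of the complement of the summand `P(B)`. -/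
def relIncl (B X : C) : schurRel P B X ⟶ schur P (X ⊞ B) :=
  Limits.Sigma.map fun n : ℕ => coinvMap P (relPowIncl B X n) (relPowIncl_swap B X n)

theorem schurRelι_map {B B' X X' : C} (g : B ⟶ B') (f : X ⟶ X') (n : ℕ) :
    schurRelι P B X n ≫ schurRelMap P g f = P.obj n ◁ relPowMap g f n ≫ schurRelι P B' X' n := by
  have h : schurRelIn P B X n ≫ schurRelMap P g f =
      coinvMap P (relPowMap g f n) (relPowMap_swap g f n) ≫ schurRelIn P B' X' n :=
    Sigma.ι_map _ _
  rw [schurRelι, Category.assoc, h, coinvMk_map_assoc, schurRelι]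

theorem schurι_proj (B X : C) (n : ℕ) :
    schurι P (X ⊞ B) n ≫ relProj P B X = P.obj n ◁ relPowProj B X n ≫ schurRelι P B X n := by
  have h : schurIn P (X ⊞ B) n ≫ relProj P B X =
      coinvMap P (relPowProj B X n) (relPowProj_swap B X n) ≫ schurRelIn P B X n :=
    Sigma.ι_map _ _
  rw [schurι, Category.assoc, h, coinvMk_map_assoc, schurRelι]

theorem schurRelι_incl (B X : C) (n : ℕ) :
    schurRelι P B X n ≫ relIncl P B X = P.obj n ◁ relPowIncl B X n ≫ schurι P (X ⊞ B) n := by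
  have h : schurRelIn P B X n ≫ relIncl P B X =
      coinvMap P (relPowIncl B X n) (relPowIncl_swap B X n) ≫ schurIn P (X ⊞ B) n :=
    Sigma.ι_map _ _
  rw [schurRelι, Category.assoc, h, coinvMk_map_assoc, schurι]

theorem schurRelMap_id (B X : C) : schurRelMap P (𝟙 B) (𝟙 X) = 𝟙 _ := by
  refine schurRel_hom_ext P fun n => ?_
  rw [schurRelι_map, relPowMap_id, whiskerLeft_id, Category.id_comp, Category.comp_id]

theorem schurRelMap_comp {B B' B'' X X' X'' : C} (g : B ⟶ B') (g' : B' ⟶ B'') (f : X ⟶ X')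
    (f' : X' ⟶ X'') :
    schurRelMap P (g ≫ g') (f ≫ f') = schurRelMap P g f ≫ schurRelMap P g' f' := by
  refine schurRel_hom_ext P fun n => ?_
  rw [schurRelι_map, relPowMap_comp, whiskerLeft_comp_assoc,
    ← Category.assoc (schurRelι P B X n), schurRelι_map, Category.assoc, schurRelι_map]

theorem relProj_natural {B B' X X' : C} (g : B ⟶ B') (f : X ⟶ X') :
    relProj P B X ≫ schurRelMap P g f = schurMap P (biprod.map f g) ≫ relProj P B' X' := by
  refine schur_hom_ext P fun n => ?_
  rw [← Category.assoc, schurι_proj, Category.assoc, schurRelι_map, ← Category.assoc (schurι P _ n),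
    schurι_map, Category.assoc, schurι_proj, ← whiskerLeft_comp_assoc, ← whiskerLeft_comp_assoc,
    relPowProj_map]

theorem relIncl_natural {B B' X X' : C} (g : B ⟶ B') (f : X ⟶ X') :
    schurRelMap P g f ≫ relIncl P B' X' = relIncl P B X ≫ schurMap P (biprod.map f g) := by
  refine schurRel_hom_ext P fun n => ?_
  rw [← Category.assoc, schurRelι_map, Category.assoc, schurRelι_incl,
    ← Category.assoc (schurRelι P _ _ n), schurRelι_incl, Category.assoc, schurι_map,
    ← whiskerLeft_comp_assoc, ← whiskerLeft_comp_assoc, relPowIncl_natural]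

variable [MonoidalClosed C]

theorem relIncl_snd (B X : C) : relIncl P B X ≫ schurMap P (biprod.snd : X ⊞ B ⟶ B) = 0 := by
  refine schurRel_hom_ext P fun n => ?_
  rw [← Category.assoc, schurRelι_incl, Category.assoc, schurι_map, ← whiskerLeft_comp_assoc,
    relPowIncl_snd, whiskerLeft_zero_of_closed, zero_comp, comp_zero]

/-- The restriction `P ∘ (P(B)|P ∘ (B|X)) → P ∘ (B|X)` of the multiplication
`P(P(X ⊕ B)) → P(X ⊕ B)` to the indicated summands, where `P(X ⊕ B)` is identified with
`P ∘ (B|X) ⊕ P(B)`. -/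
def relMul (B X : C) : schurRel P (schur P B) (schurRel P B X) ⟶ schurRel P B X :=
  relIncl P (schur P B) (schurRel P B X) ≫
    schurMap P (biprod.desc (relIncl P B X) (schurMap P biprod.inr)) ≫
      schurMul P (X ⊞ B) ≫ relProj P B X

/-- Algebras over the operad `P`: algebras over the monad `P(-)`. -/
structure PAlg (P : SymmOperad C) where
  /-- the underlying object -/
  carrier : C
  /-- the structure morphism -/
  str : schur P carrier ⟶ carrier
  unit : schurOne P carrier ≫ str = 𝟙 carrier
  assoc : schurMap P str ≫ str = schurMul P carrier ≫ str

/-- Morphisms of algebras. -/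
@[ext]
structure PAlg.Hom {P : SymmOperad C} (A B : PAlg P) where
  /-- the underlying morphism -/
  hom : A.carrier ⟶ B.carrier
  comm : schurMap P hom ≫ B.str = A.str ≫ hom

/-- The category of algebras over `P`. -/
instance (P : SymmOperad C) : Category (PAlg P) where
  Hom := PAlg.Hom
  id A := ⟨𝟙 _, by rw [schurMap_id, Category.id_comp, Category.comp_id]⟩
  comp f g := ⟨f.hom ≫ g.hom, by
    rw [schurMap_comp, Category.assoc, g.comm, ← Category.assoc, f.comm, Category.assoc]⟩
  id_comp _ := PAlg.Hom.ext (Category.id_comp _)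
  comp_id _ := PAlg.Hom.ext (Category.comp_id _)
  assoc _ _ _ := PAlg.Hom.ext (Category.assoc _ _ _)

/-- The morphism `ρ : P ∘ (B|X) → X` is an internal action of the algebra `B` on the
algebra `X`. -/
structure IsInternalAction {P : SymmOperad C} (B X : PAlg P)
    (ρ : schurRel P B.carrier X.carrier ⟶ X.carrier) : Prop where
  /-- compatibility with the structure morphism of `X` -/
  compat : (schurMap P biprod.inl ≫ relProj P B.carrier X.carrier) ≫ ρ = X.str
  /-- associativity of the action -/
  assoc : relMul P B.carrier X.carrier ≫ ρ = schurRelMap P B.str ρ ≫ ρ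

/-- Triples `(B, X, ρ)`, where `ρ` is an internal action of the algebra `B` on the algebra `X`. -/
structure Act (P : SymmOperad C) where
  /-- the acting algebra -/
  B : PAlg P
  /-- the algebra that is acted upon -/
  X : PAlg P
  /-- the action -/
  ρ : schurRel P B.carrier X.carrier ⟶ X.carrier
  isAction : IsInternalAction B X ρ

/-- Morphisms of internal actions. -/
@[ext]
structure Act.Hom {P : SymmOperad C} (S T : Act P) where
  /-- the morphism between the acting algebras -/
  g : S.B ⟶ T.B
  /-- the morphism between the algebras that are acted upon -/
  f : S.X ⟶ T.X
  comm : schurRelMap P g.hom f.hom ≫ T.ρ = S.ρ ≫ f.hom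

/-- The category of internal actions. -/
instance (P : SymmOperad C) : Category (Act P) where
  Hom := Act.Hom
  id S := ⟨𝟙 _, 𝟙 _, by
    change schurRelMap P (𝟙 _) (𝟙 _) ≫ S.ρ = S.ρ ≫ 𝟙 _
    rw [schurRelMap_id, Category.id_comp, Category.comp_id]⟩
  comp a b := ⟨a.g ≫ b.g, a.f ≫ b.f, by
    change schurRelMap P (a.g.hom ≫ b.g.hom) (a.f.hom ≫ b.f.hom) ≫ _ = _ ≫ a.f.hom ≫ b.f.hom
    rw [schurRelMap_comp, Category.assoc, b.comm, ← Category.assoc, a.comm, Category.assoc]⟩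
  id_comp _ := Act.Hom.ext (Category.id_comp _) (Category.id_comp _)
  comp_id _ := Act.Hom.ext (Category.comp_id _) (Category.comp_id _)
  assoc _ _ _ := Act.Hom.ext (Category.assoc _ _ _) (Category.assoc _ _ _)

/-- Split short exact sequences `0 → X → E → B → 0` of algebras, with a section `s : B → E`;
exactness is exactness of the underlying sequence in `C`. -/
structure SplitExt (P : SymmOperad C) where
  /-- the kernel -/
  X : PAlg P
  /-- the middle term -/
  E : PAlg P
  /-- the quotient -/
  B : PAlg P
  /-- the inclusion of the kernel -/
  i : X ⟶ E
  /-- the quotient morphism -/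
  p : E ⟶ B
  /-- the section -/
  s : B ⟶ E
  section_comp : s ≫ p = 𝟙 B
  zero : i.hom ≫ p.hom = 0
  exact : (ShortComplex.mk i.hom p.hom zero).ShortExact

/-- Morphisms of split short exact sequences. -/
@[ext]
structure SplitExt.Hom {P : SymmOperad C} (S T : SplitExt P) where
  /-- the morphism between the kernels -/
  f : S.X ⟶ T.X
  /-- the morphism between the middle terms -/
  h : S.E ⟶ T.E
  /-- the morphism between the quotients -/
  g : S.B ⟶ T.B
  comm_i : S.i ≫ h = f ≫ T.i
  comm_p : S.p ≫ g = h ≫ T.p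
  comm_s : S.s ≫ h = g ≫ T.s

/-- The category of split short exact sequences of algebras. -/
instance (P : SymmOperad C) : Category (SplitExt P) where
  Hom := SplitExt.Hom
  id S := ⟨𝟙 _, 𝟙 _, 𝟙 _, by simp, by simp, by simp⟩
  comp a b := ⟨a.f ≫ b.f, a.h ≫ b.h, a.g ≫ b.g,
    by rw [← Category.assoc, a.comm_i, Category.assoc, b.comm_i, Category.assoc],
    by rw [← Category.assoc, a.comm_p, Category.assoc, b.comm_p, Category.assoc],
    by rw [← Category.assoc, a.comm_s, Category.assoc, b.comm_s, Category.assoc]⟩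
  id_comp _ := SplitExt.Hom.ext (Category.id_comp _) (Category.id_comp _) (Category.id_comp _)
  comp_id _ := SplitExt.Hom.ext (Category.comp_id _) (Category.comp_id _) (Category.comp_id _)
  assoc _ _ _ := SplitExt.Hom.ext (Category.assoc _ _ _) (Category.assoc _ _ _)
    (Category.assoc _ _ _)

/-! ### From actions to split short exact sequences -/

/-- The structure morphism of the semidirect product, given by the matrix with diagonal entries
`ρ` and the structure morphism of `B`:
`P(X ⊕ B) = P ∘ (B|X) ⊕ P(B) → X ⊕ B`. -/
def Act.semidirectStr {P : SymmOperad C} (S : Act P) :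
    schur P (S.X.carrier ⊞ S.B.carrier) ⟶ S.X.carrier ⊞ S.B.carrier :=
  biprod.lift (relProj P _ _ ≫ S.ρ) (schurMap P biprod.snd ≫ S.B.str)

/-- `X ⊕ B`, with the above structure morphism, is an algebra, and the canonical morphisms
`X → X ⊕ B` and `B → X ⊕ B` are morphisms of algebras. -/
structure Act.IsSemidirect {P : SymmOperad C} (S : Act P) : Prop where
  unit : schurOne P _ ≫ S.semidirectStr = 𝟙 _
  assoc : schurMap P S.semidirectStr ≫ S.semidirectStr = schurMul P _ ≫ S.semidirectStr
  inl_comm : schurMap P biprod.inl ≫ S.semidirectStr = S.X.str ≫ biprod.inl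
  inr_comm : schurMap P biprod.inr ≫ S.semidirectStr = S.B.str ≫ biprod.inr

/-- The split short exact sequence `0 → X → X ⊕ B → B → 0` given by an action. -/
def Act.toSplitExt {P : SymmOperad C} (S : Act P) (hS : S.IsSemidirect) : SplitExt P where
  X := S.X
  E := ⟨S.X.carrier ⊞ S.B.carrier, S.semidirectStr, hS.unit, hS.assoc⟩
  B := S.B
  i := ⟨biprod.inl, hS.inl_comm⟩
  p := ⟨biprod.snd, (biprod.lift_snd _ _).symm⟩
  s := ⟨biprod.inr, hS.inr_comm⟩
  section_comp := PAlg.Hom.ext biprod.inr_snd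
  zero := biprod.inl_snd
  exact := (ShortComplex.Splitting.ofHasBinaryBiproduct _ _).shortExact

/-- The functor from actions to split short exact sequences, given on a morphism `(g, f)` by `f`,
`f ⊕ g` and `g`. -/
def actToSplitExt (P : SymmOperad C) (h : ∀ S : Act P, S.IsSemidirect) : Act P ⥤ SplitExt P where
  obj S := S.toSplitExt (h S)
  map {S T} a :=
    { f := a.f
      h := ⟨biprod.map a.f.hom a.g.hom, by
        change schurMap P _ ≫ T.semidirectStr = S.semidirectStr ≫ _
        apply biprod.hom_ext
        · simp only [Act.semidirectStr, Category.assoc, biprod.lift_fst, biprod.map_fst,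
            biprod.lift_fst_assoc]
          rw [← a.comm, ← Category.assoc, ← relProj_natural, Category.assoc]
        · simp only [Act.semidirectStr, Category.assoc, biprod.lift_snd, biprod.map_snd,
            biprod.lift_snd_assoc]
          rw [← a.g.comm, ← Category.assoc, ← schurMap_comp, biprod.map_snd, schurMap_comp,
            Category.assoc]⟩
      g := a.g
      comm_i := PAlg.Hom.ext (biprod.inl_map _ _)
      comm_p := PAlg.Hom.ext (biprod.map_snd _ _).symm
      comm_s := PAlg.Hom.ext (biprod.inr_map _ _) }
  map_id S := SplitExt.Hom.ext rfl (PAlg.Hom.ext (by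
    change biprod.map (𝟙 S.X.carrier) (𝟙 S.B.carrier) = 𝟙 _
    ext <;> simp)) rfl
  map_comp a b := SplitExt.Hom.ext rfl (PAlg.Hom.ext (by
    change biprod.map (a.f.hom ≫ b.f.hom) (a.g.hom ≫ b.g.hom) = biprod.map _ _ ≫ biprod.map _ _
    ext <;> simp)) rfl

/-! ### From split short exact sequences to actions -/

/-- The restriction to `P ∘ (B|X)` of the morphism `P(X ⊕ B) → P(E) → E` given by the inclusion
of `X`, the section of `B` and the structure morphism of `E`. -/
def SplitExt.preAction {P : SymmOperad C} (S : SplitExt P) :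
    schurRel P S.B.carrier S.X.carrier ⟶ S.E.carrier :=
  relIncl P _ _ ≫ schurMap P (biprod.desc S.i.hom S.s.hom) ≫ S.E.str

theorem SplitExt.preAction_comp {P : SymmOperad C} (S : SplitExt P) :
    S.preAction ≫ S.p.hom = 0 := by
  have h : biprod.desc S.i.hom S.s.hom ≫ S.p.hom = biprod.snd := by
    have := congrArg PAlg.Hom.hom S.section_comp
    apply biprod.hom_ext'
    · rw [biprod.inl_desc_assoc, S.zero, biprod.inl_snd]
    · rw [biprod.inr_desc_assoc, biprod.inr_snd]; exact this
  rw [preAction, Category.assoc, Category.assoc, ← S.p.comm, ← Category.assoc (schurMap P _),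
    ← schurMap_comp, h, ← Category.assoc, relIncl_snd, zero_comp]

/-- The morphism `ρ : P ∘ (B|X) → X` induced by a split short exact sequence: the unique one whose
composite with the inclusion `X → E` is the restriction of the structure morphism of `E`. -/
def SplitExt.ρ {P : SymmOperad C} (S : SplitExt P) :
    schurRel P S.B.carrier S.X.carrier ⟶ S.X.carrier :=
  haveI := S.exact.mono_f
  S.exact.exact.lift S.preAction S.preAction_comp

theorem SplitExt.ρ_comp {P : SymmOperad C} (S : SplitExt P) :
    S.ρ ≫ S.i.hom = S.preAction :=
  haveI := S.exact.mono_f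
  S.exact.exact.lift_f S.preAction S.preAction_comp

/-- The functor from split short exact sequences to actions, given on a morphism `(f, h, g)` by
`(g, f)`. -/
def splitExtToAct (P : SymmOperad C) (h : ∀ S : SplitExt P, IsInternalAction S.B S.X S.ρ) :
    SplitExt P ⥤ Act P where
  obj S := ⟨S.B, S.X, S.ρ, h S⟩
  map {S T} a :=
    { g := a.g
      f := a.f
      comm := by
        have := T.exact.mono_f
        have hi := congrArg PAlg.Hom.hom a.comm_i
        have hs := congrArg PAlg.Hom.hom a.comm_s
        change S.i.hom ≫ a.h.hom = a.f.hom ≫ T.i.hom at hi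
        change S.s.hom ≫ a.h.hom = a.g.hom ≫ T.s.hom at hs
        have hm : biprod.map a.f.hom a.g.hom ≫ biprod.desc T.i.hom T.s.hom =
            biprod.desc S.i.hom S.s.hom ≫ a.h.hom := by
          apply biprod.hom_ext' <;> simp [hi, hs]
        refine (cancel_mono (f := (ShortComplex.mk T.i.hom T.p.hom T.zero).f)).1 ?_
        change (schurRelMap P a.g.hom a.f.hom ≫ T.ρ) ≫ T.i.hom = (S.ρ ≫ a.f.hom) ≫ T.i.hom
        rw [Category.assoc, Category.assoc, T.ρ_comp, ← hi, ← Category.assoc, S.ρ_comp,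
          SplitExt.preAction, SplitExt.preAction, ← Category.assoc, relIncl_natural,
          Category.assoc, ← Category.assoc (schurMap P _), ← schurMap_comp, hm, schurMap_comp,
          Category.assoc, Category.assoc, Category.assoc, a.h.comm] }
  map_id _ := rfl
  map_comp _ _ := rfl

end Algebras

end OperadAction

end

/-!
The splitting `P(X ⊕ B) = P ∘ (B|X) ⊕ P(B)` turns a pair `(ρ, μᴮ)` into a block diagonal morphism
`P(X ⊕ B) → X ⊕ B`. The multiplication `P(P(X ⊕ B)) → P(X ⊕ B)` is itself block diagonal for this
splitting, so `ρ` is an internal action exactly when the block diagonal morphism is associative and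
extends `μˣ`, that is, when `X ⊕ B` is an algebra that contains `X` as a subalgebra. For a split
extension `E` of `B` by `X`, the isomorphism `(i, s) : X ⊕ B ≅ E` transports the structure of `E`
to the block diagonal morphism of the induced `ρ`. As `P 0 = 0`, the functor `P(-)` preserves zero
morphisms, so `P(X) → P(X ⊕ B) → P(B)` vanishes and `P(X)` lies in the summand `P ∘ (B|X)`.
-/

noncomputable section

namespace OperadAction

section Additivity

theorem additive_of_isLeftAdjoint {C D : Type*} [Category* C] [Category* D] [Preadditive C]
    [Preadditive D] [HasBinaryBiproducts C] (F : C ⥤ D) [F.IsLeftAdjoint] : F.Additive :=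
  have := F.preservesZeroMorphisms_of_isLeftAdjoint
  have : PreservesColimitsOfSize.{0, 0} F :=
    (Adjunction.ofIsLeftAdjoint F).leftAdjoint_preservesColimits
  have := preservesBinaryBiproducts_of_preservesBinaryCoproducts F
  F.additive_of_preservesBinaryBiproducts

variable {C : Type*} [Category* C] [Preadditive C] [MonoidalCategory C]

instance [HasBinaryBiproducts C] [BraidedCategory C] [MonoidalClosed C] :
    MonoidalPreadditive C :=
  have : ∀ X : C, (tensorLeft X).Additive := fun _ => additive_of_isLeftAdjoint _
  have : ∀ X : C, (tensorRight X).Additive := fun X =>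
    Functor.additive_of_iso (BraidedCategory.tensorLeftIsoTensorRight X)
  { whiskerLeft_zero := (tensorLeft _).map_zero _ _
    zero_whiskerRight := (tensorRight _).map_zero _ _
    whiskerLeft_add := fun _ _ => (tensorLeft _).map_add
    add_whiskerRight := fun _ _ => (tensorRight _).map_add }

variable [MonoidalPreadditive C]

theorem tpowMap_zero (X Y : C) (n : ℕ) : tpowMap (0 : X ⟶ Y) (n + 1) = 0 :=
  MonoidalPreadditive.tensor_zero _

end Additivity

section Naturality

variable {C : Type u} [Category.{v} C] [MonoidalCategory C]

/-- The tensor product `F a₁ ⊗ ⋯ ⊗ F aₙ ⟶ G a₁ ⊗ ⋯ ⊗ G aₙ` of the morphisms `φ aᵢ`. Unlike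
`tensMap id φ`, its codomain is indexed by the sequence `v` itself instead of `v.map id`. -/
def tensHom {α : Type*} {F G : α → C} (φ : ∀ a, F a ⟶ G a) :
    {n : ℕ} → (v : Vec α n) → (tens F v ⟶ tens G v)
  | _, .nil => 𝟙 _
  | _, .snoc v a => tensHom φ v ⊗ₘ φ a

theorem tensToPow_comp_tpowMap {α : Type*} {F : α → C} {X Y : C} (φ : ∀ a, F a ⟶ X)
    (g : X ⟶ Y) {n : ℕ} (v : Vec α n) :
    tensToPow φ v ≫ tpowMap g n = tensToPow (fun a => φ a ≫ g) v := by
  induction v with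
  | nil => exact Category.comp_id _
  | snoc v a ih =>
    simp only [tensToPow, tpowMap, ← ih]
    exact tensorHom_comp_tensorHom _ _ _ _

theorem tensHom_comp_tensToPow {α : Type*} {F G : α → C} {X : C} (φ : ∀ a, F a ⟶ G a)
    (ψ : ∀ a, G a ⟶ X) {n : ℕ} (v : Vec α n) :
    tensHom φ v ≫ tensToPow ψ v = tensToPow (fun a => φ a ≫ ψ a) v := by
  induction v with
  | nil => exact Category.comp_id _
  | snoc v a ih =>
    simp only [tensToPow, tensHom, ← ih]
    exact tensorHom_comp_tensorHom _ _ _ _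

/-- The identification of `X` with its first tensor power, which is `𝟙_ C ⊗ X` by definition. -/
def toTpowOne (X : C) : X ⟶ tpow X 1 :=
  (λ_ X).inv

theorem toTpowOne_natural {X Y : C} (f : X ⟶ Y) :
    toTpowOne X ≫ tpowMap f 1 = f ≫ toTpowOne Y := by
  change (λ_ X).inv ≫ (𝟙 (𝟙_ C) ⊗ₘ f) = f ≫ (λ_ Y).inv
  rw [id_tensorHom, leftUnitor_inv_naturality]

theorem tpowAdd_hom_natural {X Y : C} (f : X ⟶ Y) (a b : ℕ) :
    (tpowMap f a ⊗ₘ tpowMap f b) ≫ (tpowAdd Y a b).hom =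
      (tpowAdd X a b).hom ≫ tpowMap f (a + b) := by
  induction b with
  | zero =>
    change (tpowMap f a ⊗ₘ 𝟙 (𝟙_ C)) ≫ (ρ_ _).hom = (ρ_ _).hom ≫ tpowMap f a
    rw [tensorHom_id, rightUnitor_naturality]
  | succ b ih =>
    change (tpowMap f a ⊗ₘ (tpowMap f b ⊗ₘ f)) ≫ (α_ _ _ _).inv ≫ (tpowAdd Y a b).hom ▷ Y =
      ((α_ _ _ _).inv ≫ (tpowAdd X a b).hom ▷ X) ≫ (tpowMap f (a + b) ⊗ₘ f)
    rw [associator_inv_naturality_assoc, tensorHom_comp_whiskerRight, ih, Category.assoc,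
      whiskerRight_comp_tensorHom]

theorem tensorμ_natural_whiskerLeft [BraidedCategory C] (U Q : C) {V V' A A' : C}
    (g : V ⟶ V') (h : A ⟶ A') :
    (U ◁ g ⊗ₘ Q ◁ h) ≫ tensorμ U V' Q A' = tensorμ U V Q A ≫ (U ⊗ Q) ◁ (g ⊗ₘ h) := by
  simpa only [id_tensorHom, whiskerLeft_id] using tensorμ_natural (𝟙 U) g (𝟙 Q) h

variable [SymmetricCategory C]

theorem unzipPow_natural (F : ℕ → C) {X Y : C} (f : X ⟶ Y) {n : ℕ} (k : Vec ℕ n) :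
    tensHom (fun a => F a ◁ tpowMap f a) k ≫ unzipPow F Y k =
      unzipPow F X k ≫ tens F k ◁ tpowMap f k.sum := by
  induction k with
  | nil =>
    change 𝟙 _ ≫ (λ_ (𝟙_ C)).inv = (λ_ (𝟙_ C)).inv ≫ 𝟙_ C ◁ 𝟙 (𝟙_ C)
    rw [whiskerLeft_id, Category.id_comp, Category.comp_id]
  | snoc k a ih =>
    calc (tensHom (fun a => F a ◁ tpowMap f a) k ⊗ₘ F a ◁ tpowMap f a) ≫
          unzipPow F Y k ▷ (F a ⊗ tpow Y a) ≫ tensorμ _ _ _ _ ≫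
            (tens F k ⊗ F a) ◁ (tpowAdd Y k.sum a).hom
      _ = unzipPow F X k ▷ (F a ⊗ tpow X a) ≫
            (tens F k ◁ tpowMap f k.sum ⊗ₘ F a ◁ tpowMap f a) ≫ tensorμ _ _ _ _ ≫
              (tens F k ⊗ F a) ◁ (tpowAdd Y k.sum a).hom := by
        rw [tensorHom_comp_whiskerRight_assoc, ih, whiskerRight_comp_tensorHom_assoc]
      _ = unzipPow F X k ▷ (F a ⊗ tpow X a) ≫ tensorμ _ _ _ _ ≫
            (tens F k ⊗ F a) ◁ ((tpowAdd X k.sum a).hom ≫ tpowMap f (k.sum + a)) := by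
        rw [reassoc_of% tensorμ_natural_whiskerLeft, ← whiskerLeft_comp, tpowAdd_hom_natural]
      _ = (unzipPow F X k ▷ (F a ⊗ tpow X a) ≫ tensorμ _ _ _ _ ≫
            (tens F k ⊗ F a) ◁ (tpowAdd X k.sum a).hom) ≫
              (tens F k ⊗ F a) ◁ tpowMap f (k.sum + a) := by
        simp only [whiskerLeft_comp, Category.assoc]

theorem opComp_natural (P : SymmOperad C) {X Y : C} (f : X ⟶ Y) {n : ℕ} (k : Vec ℕ n) :
    P.obj n ◁ tensHom (fun a => P.obj a ◁ tpowMap f a) k ≫ opComp P Y k =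
      opComp P X k ≫ P.obj k.sum ◁ tpowMap f k.sum := by
  simp only [opComp, Category.assoc]
  rw [← whiskerLeft_comp_assoc, unzipPow_natural, whiskerLeft_comp_assoc,
    associator_inv_naturality_right_assoc, whisker_exchange]

end Naturality

section Schur

variable {C : Type u} [Category.{v} C] [Abelian C] [HasCoproducts.{0} C] [MonoidalCategory C]
  [SymmetricCategory C] (P : SymmOperad C)

instance {X Y : C} (f : X ⟶ Y) [IsIso f] : IsIso (schurMap P f) :=
  ⟨schurMap P (inv f), by rw [← schurMap_comp, IsIso.hom_inv_id, schurMap_id],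
    by rw [← schurMap_comp, IsIso.inv_hom_id, schurMap_id]⟩

theorem schurMap_zero [MonoidalPreadditive C] (hP : IsZero (P.obj 0)) (X Y : C) :
    schurMap P (0 : X ⟶ Y) = 0 := by
  refine schur_hom_ext P fun n => ?_
  cases n with
  | zero => exact ((tensorRight (tpow X 0)).map_isZero hP).eq_of_src _ _
  | succ n => rw [schurι_map, tpowMap_zero, MonoidalPreadditive.whiskerLeft_zero, zero_comp,
      comp_zero]

theorem schurOne_eq (X : C) :
    schurOne P X = (λ_ X).inv ≫ (P.one ⊗ₘ toTpowOne X) ≫ schurι P X 1 :=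
  rfl

theorem schurOne_natural {X Y : C} (f : X ⟶ Y) :
    schurOne P X ≫ schurMap P f = f ≫ schurOne P Y := by
  simp only [schurOne_eq, Category.assoc]
  rw [schurι_map, tensorHom_comp_whiskerLeft_assoc, toTpowOne_natural,
    leftUnitor_inv_naturality_assoc, whiskerLeft_comp_tensorHom_assoc]

variable [MonoidalClosed C]

theorem schurMul_natural {X Y : C} (f : X ⟶ Y) :
    schurMap P (schurMap P f) ≫ schurMul P Y = schurMul P X ≫ schurMap P f := by
  refine schur_hom_ext P fun n => schur_pow_hom_ext P fun k => ?_
  have tensToPow_schurι : tensToPow (schurι P X) k ≫ tpowMap (schurMap P f) n =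
      tensHom (fun a => P.obj a ◁ tpowMap f a) k ≫ tensToPow (schurι P Y) k := by
    simp only [tensToPow_comp_tpowMap, tensHom_comp_tensToPow, schurι_map]
  rw [reassoc_of% schurι_map, ← whiskerLeft_comp_assoc, tensToPow_schurι, whiskerLeft_comp_assoc,
    schurMul_spec, reassoc_of% opComp_natural, reassoc_of% schurMul_spec, schurι_map]

end Schur

section Splitting

variable {C : Type u} [Category.{v} C] [Abelian C] [MonoidalCategory C]

theorem relPowIncl_relPowProj (B X : C) (n : ℕ) :
    relPowIncl B X n ≫ relPowProj B X n = 𝟙 _ := by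
  refine relPow_hom_ext ?_
  have inr_proj : tpowMap (biprod.inr : B ⟶ X ⊞ B) n ≫ relPowProj B X n = 0 :=
    cokernel.condition _
  rw [reassoc_of% relPowProj_incl, Preadditive.sub_comp, tpowMap_comp, Category.assoc, inr_proj,
    comp_zero, sub_zero, Category.id_comp, Category.comp_id]

variable [SymmetricCategory C] [HasCoproducts.{0} C] (P : SymmOperad C)

theorem relIncl_relProj (B X : C) : relIncl P B X ≫ relProj P B X = 𝟙 _ := by
  refine schurRel_hom_ext P fun n => ?_
  rw [reassoc_of% schurRelι_incl, schurι_proj, ← whiskerLeft_comp_assoc, relPowIncl_relPowProj,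
    whiskerLeft_id, Category.id_comp, Category.comp_id]

theorem relProj_relIncl [MonoidalPreadditive C] (B X : C) : relProj P B X ≫ relIncl P B X =
    𝟙 _ - schurMap P (biprod.snd : X ⊞ B ⟶ B) ≫ schurMap P biprod.inr := by
  refine schur_hom_ext P fun n => ?_
  have whiskerLeft_sub : P.obj n ◁ (𝟙 _ - tpowMap (biprod.snd ≫ biprod.inr) n) =
      𝟙 _ - P.obj n ◁ tpowMap (biprod.snd ≫ biprod.inr : X ⊞ B ⟶ X ⊞ B) n :=
    ((tensorLeft (P.obj n)).map_sub).trans (congrArg (· - _) (whiskerLeft_id _ _))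
  rw [reassoc_of% schurι_proj, schurRelι_incl, ← whiskerLeft_comp_assoc, relPowProj_incl,
    whiskerLeft_sub, Preadditive.sub_comp, Preadditive.comp_sub, ← schurMap_comp, schurι_map,
    Category.id_comp, Category.comp_id]

variable [MonoidalClosed C]

/-- The splitting of `0 → P ∘ (B|X) → P(X ⊕ B) → P(B) → 0` whose section is induced by the
inclusion of `B`. -/
def schurSplitting (B X : C) :
    (ShortComplex.mk (relIncl P B X) (schurMap P biprod.snd) (relIncl_snd P B X)).Splitting where
  r := relProj P B X
  s := schurMap P biprod.inr
  f_r := relIncl_relProj P B X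
  s_g := by rw [← schurMap_comp, biprod.inr_snd, schurMap_id]
  id := by rw [relProj_relIncl, sub_add_cancel]

theorem schurMap_inr_relProj (B X : C) :
    schurMap P (biprod.inr : B ⟶ X ⊞ B) ≫ relProj P B X = 0 :=
  (schurSplitting P B X).s_r

/-- The identification `P(X ⊕ B) ≅ P ∘ (B|X) ⊕ P(B)`. -/
def schurBiprodIso (B X : C) : schur P (X ⊞ B) ≅ schurRel P B X ⊞ schur P B :=
  (schurSplitting P B X).isoBinaryBiproduct

theorem schurBiprodIso_inv (B X : C) :
    (schurBiprodIso P B X).inv = biprod.desc (relIncl P B X) (schurMap P biprod.inr) :=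
  rfl

theorem relProj_relMul (B X : C) : relProj P (schur P B) (schurRel P B X) ≫ relMul P B X =
    schurMap P (schurBiprodIso P B X).inv ≫ schurMul P (X ⊞ B) ≫ relProj P B X := by
  have summand_schur : schurMap P (biprod.inr : schur P B ⟶ _) ≫
      schurMap P (schurBiprodIso P B X).inv ≫ schurMul P (X ⊞ B) ≫ relProj P B X = 0 := by
    rw [← reassoc_of% schurMap_comp, schurBiprodIso_inv, biprod.inr_desc,
      reassoc_of% schurMul_natural, schurMap_inr_relProj, comp_zero]
  rw [relMul, reassoc_of% relProj_relIncl, ← schurBiprodIso_inv, Preadditive.sub_comp,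
    Category.id_comp, Category.assoc, summand_schur, comp_zero, sub_zero]

end Splitting

section BlockDiagonal

variable {C : Type u} [Category.{v} C] [Abelian C] [HasCoproducts.{0} C] [MonoidalCategory C]
  [SymmetricCategory C] (P : SymmOperad C)

/-- The block diagonal morphism `P(X ⊕ B) = P ∘ (B|X) ⊕ P(B) ⟶ X ⊕ B` with entries `ρ` and `β`,
for arbitrary `ρ` and `β`; `Act.semidirectStr` is the case of an action. -/
def biprodStr {B X : C} (ρ : schurRel P B X ⟶ X) (β : schur P B ⟶ B) :
    schur P (X ⊞ B) ⟶ X ⊞ B :=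
  biprod.lift (relProj P B X ≫ ρ) (schurMap P biprod.snd ≫ β)

variable {P} {B X : C} (ρ : schurRel P B X ⟶ X) (β : schur P B ⟶ B)

theorem biprodStr_fst : biprodStr P ρ β ≫ biprod.fst = relProj P B X ≫ ρ :=
  biprod.lift_fst _ _

theorem biprodStr_snd : biprodStr P ρ β ≫ biprod.snd = schurMap P biprod.snd ≫ β :=
  biprod.lift_snd _ _

variable [MonoidalClosed C]

theorem relIncl_biprodStr : relIncl P B X ≫ biprodStr P ρ β = ρ ≫ biprod.inl := by
  apply biprod.hom_ext
  · rw [Category.assoc, biprodStr_fst, reassoc_of% relIncl_relProj, Category.assoc,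
      biprod.inl_fst, Category.comp_id]
  · rw [Category.assoc, biprodStr_snd, reassoc_of% relIncl_snd, zero_comp, Category.assoc,
      biprod.inl_snd, comp_zero]

theorem schurMap_inr_biprodStr :
    schurMap P biprod.inr ≫ biprodStr P ρ β = β ≫ biprod.inr := by
  apply biprod.hom_ext
  · rw [Category.assoc, biprodStr_fst, reassoc_of% schurMap_inr_relProj, zero_comp,
      Category.assoc, biprod.inr_fst, comp_zero]
  · rw [Category.assoc, biprodStr_snd, ← reassoc_of% schurMap_comp, biprod.inr_snd, schurMap_id,
      Category.id_comp, Category.assoc, biprod.inr_snd, Category.comp_id]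

theorem schurBiprodIso_inv_biprodStr :
    (schurBiprodIso P B X).inv ≫ biprodStr P ρ β = biprod.map ρ β := by
  apply biprod.hom_ext'
  · rw [schurBiprodIso_inv, biprod.inl_desc_assoc, relIncl_biprodStr, biprod.inl_map]
  · rw [schurBiprodIso_inv, biprod.inr_desc_assoc, schurMap_inr_biprodStr, biprod.inr_map]

variable {β}

theorem biprodStr_assoc_snd (hβ : schurMap P β ≫ β = schurMul P B ≫ β) :
    (schurMap P (biprodStr P ρ β) ≫ biprodStr P ρ β) ≫ biprod.snd =
      (schurMul P _ ≫ biprodStr P ρ β) ≫ biprod.snd := by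
  rw [Category.assoc, Category.assoc, biprodStr_snd, ← reassoc_of% schurMap_comp, biprodStr_snd,
    schurMap_comp, Category.assoc, hβ, reassoc_of% schurMul_natural]

theorem biprodStr_assoc_iff (hβ : schurMap P β ≫ β = schurMul P B ≫ β) :
    schurMap P (biprodStr P ρ β) ≫ biprodStr P ρ β = schurMul P _ ≫ biprodStr P ρ β ↔
      relMul P B X ≫ ρ = schurRelMap P β ρ ≫ ρ := by
  have : IsSplitEpi (relProj P (schur P B) (schurRel P B X)) := .mk' ⟨_, relIncl_relProj P _ _⟩
  have left_restrict : schurMap P (schurBiprodIso P B X).inv ≫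
      schurMap P (biprodStr P ρ β) ≫ relProj P B X ≫ ρ =
        relProj P _ _ ≫ schurRelMap P β ρ ≫ ρ := by
    rw [← reassoc_of% schurMap_comp, schurBiprodIso_inv_biprodStr, reassoc_of% relProj_natural]
  have right_restrict : schurMap P (schurBiprodIso P B X).inv ≫
      schurMul P _ ≫ relProj P B X ≫ ρ = relProj P _ _ ≫ relMul P B X ≫ ρ := by
    rw [reassoc_of% relProj_relMul]
  calc schurMap P (biprodStr P ρ β) ≫ biprodStr P ρ β = schurMul P _ ≫ biprodStr P ρ β
    _ ↔ schurMap P (biprodStr P ρ β) ≫ relProj P B X ≫ ρ = schurMul P _ ≫ relProj P B X ≫ ρ := by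
      rw [← biprodStr_fst ρ β, ← Category.assoc, ← Category.assoc]
      exact ⟨(· =≫ _), fun h => biprod.hom_ext _ _ h (biprodStr_assoc_snd ρ hβ)⟩
    _ ↔ relProj P _ _ ≫ schurRelMap P β ρ ≫ ρ = relProj P _ _ ≫ relMul P B X ≫ ρ := by
      rw [← left_restrict, ← right_restrict, cancel_epi]
    _ ↔ relMul P B X ≫ ρ = schurRelMap P β ρ ≫ ρ := by rw [cancel_epi, eq_comm]

theorem schurMap_inl_biprodStr_iff (hP : IsZero (P.obj 0)) {ξ : schur P X ⟶ X} :
    schurMap P biprod.inl ≫ biprodStr P ρ β = ξ ≫ biprod.inl ↔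
      (schurMap P biprod.inl ≫ relProj P B X) ≫ ρ = ξ := by
  have inl_snd : (schurMap P biprod.inl ≫ biprodStr P ρ β) ≫ biprod.snd = 0 := by
    rw [Category.assoc, biprodStr_snd, ← reassoc_of% schurMap_comp, biprod.inl_snd,
      schurMap_zero P hP, zero_comp]
  have inl_fst : (schurMap P biprod.inl ≫ biprodStr P ρ β) ≫ biprod.fst =
      (schurMap P biprod.inl ≫ relProj P B X) ≫ ρ := by
    rw [Category.assoc, biprodStr_fst, Category.assoc]
  rw [← inl_fst]
  refine ⟨fun h => ?_, fun h => ?_⟩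
  · rw [h, Category.assoc, biprod.inl_fst, Category.comp_id]
  · apply biprod.hom_ext
    · rw [h, Category.assoc, biprod.inl_fst, Category.comp_id]
    · rw [inl_snd, Category.assoc, biprod.inl_snd, comp_zero]

theorem schurOne_biprodStr {ξ : schur P X ⟶ X} (hξ : schurOne P X ≫ ξ = 𝟙 X)
    (hβ : schurOne P B ≫ β = 𝟙 B)
    (hinl : schurMap P biprod.inl ≫ biprodStr P ρ β = ξ ≫ biprod.inl) :
    schurOne P _ ≫ biprodStr P ρ β = 𝟙 _ := by
  apply biprod.hom_ext'
  · rw [← reassoc_of% schurOne_natural, hinl, reassoc_of% hξ, Category.comp_id]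
  · rw [← reassoc_of% schurOne_natural, schurMap_inr_biprodStr, reassoc_of% hβ, Category.comp_id]

theorem isInternalAction_iff (hP : IsZero (P.obj 0)) {B X : PAlg P}
    {ρ : schurRel P B.carrier X.carrier ⟶ X.carrier} :
    IsInternalAction B X ρ ↔
      schurMap P biprod.inl ≫ biprodStr P ρ B.str = X.str ≫ biprod.inl ∧
        schurMap P (biprodStr P ρ B.str) ≫ biprodStr P ρ B.str =
          schurMul P _ ≫ biprodStr P ρ B.str := by
  rw [schurMap_inl_biprodStr_iff ρ hP, biprodStr_assoc_iff ρ B.assoc]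
  exact ⟨fun h => ⟨h.compat, h.assoc⟩, fun h => ⟨h.1, h.2⟩⟩

theorem Act.isSemidirect (hP : IsZero (P.obj 0)) (S : Act P) : S.IsSemidirect :=
  have ⟨inl_comm, assoc⟩ := (isInternalAction_iff hP).1 S.isAction
  { unit := schurOne_biprodStr S.ρ S.X.unit S.B.unit inl_comm
    assoc := assoc
    inl_comm := inl_comm
    inr_comm := schurMap_inr_biprodStr S.ρ S.B.str }

end BlockDiagonal

section SplitExtensions

variable {C : Type u} [Category.{v} C] [Abelian C] [HasCoproducts.{0} C] [MonoidalCategory C]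
  [SymmetricCategory C] [MonoidalClosed C] {P : SymmOperad C}

theorem assoc_of_mono (E : PAlg P) {V : C} {α : schur P V ⟶ V} (φ : V ⟶ E.carrier) [Mono φ]
    (hφ : α ≫ φ = schurMap P φ ≫ E.str) : schurMap P α ≫ α = schurMul P V ≫ α := by
  rw [← cancel_mono φ, Category.assoc, Category.assoc, hφ, ← reassoc_of% schurMap_comp, hφ,
    schurMap_comp, Category.assoc, E.assoc, reassoc_of% schurMul_natural]

namespace SplitExt

variable (S : SplitExt P)

/-- The splitting of the underlying short exact sequence given by the section. -/
def splitting : (ShortComplex.mk S.i.hom S.p.hom S.zero).Splitting :=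
  .ofExactOfSection _ S.exact.exact S.s.hom (congrArg PAlg.Hom.hom S.section_comp) S.exact.mono_f

/-- The isomorphism `(i, s) : X ⊕ B ≅ E` of underlying objects. -/
def biprodIso : S.X.carrier ⊞ S.B.carrier ≅ S.E.carrier :=
  S.splitting.isoBinaryBiproduct.symm

theorem biprodIso_hom : S.biprodIso.hom = biprod.desc S.i.hom S.s.hom :=
  rfl

theorem biprodIso_hom_p : S.biprodIso.hom ≫ S.p.hom = biprod.snd := by
  rw [biprodIso_hom]
  apply biprod.hom_ext'
  · rw [biprod.inl_desc_assoc, S.zero, biprod.inl_snd]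
  · rw [biprod.inr_desc_assoc, biprod.inr_snd]
    exact S.splitting.s_g

theorem biprodStr_biprodIso_hom : biprodStr P S.ρ S.B.str ≫ S.biprodIso.hom =
    schurMap P S.biprodIso.hom ≫ S.E.str := by
  rw [← cancel_epi (schurBiprodIso P S.B.carrier S.X.carrier).inv,
    reassoc_of% schurBiprodIso_inv_biprodStr, schurBiprodIso_inv, biprodIso_hom]
  apply biprod.hom_ext'
  · rw [biprod.inl_map_assoc, biprod.inl_desc, S.ρ_comp, biprod.inl_desc_assoc, preAction]
  · rw [biprod.inr_map_assoc, biprod.inr_desc, biprod.inr_desc_assoc,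
      ← reassoc_of% schurMap_comp, biprod.inr_desc, S.s.comm]

theorem isInternalAction (hP : IsZero (P.obj 0)) : IsInternalAction S.B S.X S.ρ := by
  refine (isInternalAction_iff hP).2 ⟨?_, assoc_of_mono S.E _ S.biprodStr_biprodIso_hom⟩
  rw [← cancel_mono S.biprodIso.hom, Category.assoc, biprodStr_biprodIso_hom,
    ← reassoc_of% schurMap_comp, Category.assoc, biprodIso_hom, biprod.inl_desc, S.i.comm]

end SplitExt

theorem Act.toSplitExt_ρ (S : Act P) (hS : S.IsSemidirect) : (S.toSplitExt hS).ρ = S.ρ := by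
  have : Mono (S.toSplitExt hS).i.hom := (S.toSplitExt hS).exact.mono_f
  have desc_inl_inr : biprod.desc biprod.inl biprod.inr = 𝟙 (S.X.carrier ⊞ S.B.carrier) := by
    ext <;> simp
  refine (cancel_mono (S.toSplitExt hS).i.hom).1 ((SplitExt.ρ_comp _).trans ?_)
  change relIncl P _ _ ≫ schurMap P (biprod.desc biprod.inl biprod.inr) ≫ S.semidirectStr =
    S.ρ ≫ biprod.inl
  rw [desc_inl_inr, schurMap_id, Category.id_comp]
  exact relIncl_biprodStr S.ρ S.B.str

end SplitExtensions

section Equivalence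

variable {C : Type u} [Category.{v} C] [Abelian C] [HasCoproducts.{0} C] [MonoidalCategory C]
  [SymmetricCategory C] [MonoidalClosed C] {P : SymmOperad C}

/-- An isomorphism of algebras from an isomorphism of the underlying objects; compatibility of the
inverse with the structure morphisms is automatic. -/
def PAlg.isoMk {A B : PAlg P} (e : A.carrier ≅ B.carrier)
    (comm : schurMap P e.hom ≫ B.str = A.str ≫ e.hom) : A ≅ B where
  hom := ⟨e.hom, comm⟩
  inv := ⟨e.inv, by
    rw [← cancel_mono e.hom, Category.assoc, ← comm, ← reassoc_of% schurMap_comp, e.inv_hom_id,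
      schurMap_id, Category.id_comp, Category.assoc, e.inv_hom_id, Category.comp_id]⟩
  hom_inv_id := PAlg.Hom.ext e.hom_inv_id
  inv_hom_id := PAlg.Hom.ext e.inv_hom_id

/-- An isomorphism of actions from isomorphisms of the two algebras. -/
def Act.isoMk {S T : Act P} (g : S.B ≅ T.B) (f : S.X ≅ T.X)
    (comm : schurRelMap P g.hom.hom f.hom.hom ≫ T.ρ = S.ρ ≫ f.hom.hom) : S ≅ T where
  hom := ⟨g.hom, f.hom, comm⟩
  inv := ⟨g.inv, f.inv, by
    have f_hom_inv : f.hom.hom ≫ f.inv.hom = 𝟙 _ := congrArg PAlg.Hom.hom f.hom_inv_id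
    have f_inv_hom : f.inv.hom ≫ f.hom.hom = 𝟙 _ := congrArg PAlg.Hom.hom f.inv_hom_id
    have g_inv_hom : g.inv.hom ≫ g.hom.hom = 𝟙 _ := congrArg PAlg.Hom.hom g.inv_hom_id
    calc schurRelMap P g.inv.hom f.inv.hom ≫ S.ρ
      _ = schurRelMap P g.inv.hom f.inv.hom ≫ (S.ρ ≫ f.hom.hom) ≫ f.inv.hom := by
        rw [Category.assoc, f_hom_inv, Category.comp_id]
      _ = T.ρ ≫ f.inv.hom := by
        rw [← comm, Category.assoc, ← reassoc_of% schurRelMap_comp, g_inv_hom, f_inv_hom,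
          schurRelMap_id, Category.id_comp]⟩
  hom_inv_id := Act.Hom.ext g.hom_inv_id f.hom_inv_id
  inv_hom_id := Act.Hom.ext g.inv_hom_id f.inv_hom_id

/-- An isomorphism of split extensions from compatible isomorphisms of the three algebras. -/
def SplitExt.isoMk {S T : SplitExt P} (f : S.X ≅ T.X) (h : S.E ≅ T.E) (g : S.B ≅ T.B)
    (comm_i : S.i ≫ h.hom = f.hom ≫ T.i) (comm_p : S.p ≫ g.hom = h.hom ≫ T.p)
    (comm_s : S.s ≫ h.hom = g.hom ≫ T.s) : S ≅ T where
  hom := ⟨f.hom, h.hom, g.hom, comm_i, comm_p, comm_s⟩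
  inv := ⟨f.inv, h.inv, g.inv,
    by rw [Iso.eq_inv_comp, ← Category.assoc, ← comm_i, Category.assoc, h.hom_inv_id,
      Category.comp_id],
    by rw [Iso.eq_inv_comp, ← Category.assoc, ← comm_p, Category.assoc, g.hom_inv_id,
      Category.comp_id],
    by rw [Iso.eq_inv_comp, ← Category.assoc, ← comm_s, Category.assoc, h.hom_inv_id,
      Category.comp_id]⟩
  hom_inv_id := SplitExt.Hom.ext f.hom_inv_id h.hom_inv_id g.hom_inv_id
  inv_hom_id := SplitExt.Hom.ext f.inv_hom_id h.inv_hom_id g.inv_hom_id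

variable (hF : ∀ S : Act P, S.IsSemidirect)
  (hG : ∀ S : SplitExt P, IsInternalAction S.B S.X S.ρ)

/-- The unit of the equivalence: by `Act.toSplitExt_ρ`, its components are the identities of the
two algebras. -/
def actUnitIso : 𝟭 (Act P) ≅ actToSplitExt P hF ⋙ splitExtToAct P hG :=
  NatIso.ofComponents
    (fun S => Act.isoMk (T := (splitExtToAct P hG).obj (S.toSplitExt (hF S))) (Iso.refl S.B)
      (Iso.refl S.X) (by
        have id_equivariant :
            schurRelMap P (𝟙 S.B.carrier) (𝟙 S.X.carrier) ≫ S.ρ = S.ρ ≫ 𝟙 _ := by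
          rw [schurRelMap_id, Category.id_comp, Category.comp_id]
        exact (congrArg (_ ≫ ·) (S.toSplitExt_ρ (hF S))).trans id_equivariant))
    (fun a => Act.Hom.ext
      ((Category.comp_id a.g).trans (Category.id_comp a.g).symm)
      ((Category.comp_id a.f).trans (Category.id_comp a.f).symm))

theorem SplitExt.Hom.biprodMap_biprodIso_hom {S T : SplitExt P} (a : S ⟶ T) :
    biprod.map a.f.hom a.g.hom ≫ T.biprodIso.hom = S.biprodIso.hom ≫ a.h.hom := by
  have comm_i : S.i.hom ≫ a.h.hom = a.f.hom ≫ T.i.hom := congrArg PAlg.Hom.hom a.comm_i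
  have comm_s : S.s.hom ≫ a.h.hom = a.g.hom ≫ T.s.hom := congrArg PAlg.Hom.hom a.comm_s
  rw [S.biprodIso_hom, T.biprodIso_hom]
  ext <;> simp [comm_i, comm_s]

/-- The component at `S` of the counit of the equivalence: the isomorphism `X ⊕ B ≅ E`, with the
identities of `X` and `B`. -/
def SplitExt.toSplitExtIso (S : SplitExt P) :
    ((splitExtToAct P hG).obj S).toSplitExt (hF _) ≅ S :=
  SplitExt.isoMk (Iso.refl S.X) (PAlg.isoMk S.biprodIso S.biprodStr_biprodIso_hom.symm)
    (Iso.refl S.B) (PAlg.Hom.ext ((biprod.inl_desc _ _).trans (Category.id_comp _).symm))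
    (PAlg.Hom.ext ((Category.comp_id _).trans S.biprodIso_hom_p.symm))
    (PAlg.Hom.ext ((biprod.inr_desc _ _).trans (Category.id_comp _).symm))

/-- The counit of the equivalence. -/
def splitExtCounitIso : splitExtToAct P hG ⋙ actToSplitExt P hF ≅ 𝟭 (SplitExt P) :=
  NatIso.ofComponents (SplitExt.toSplitExtIso hF hG)
    (fun a => SplitExt.Hom.ext
      ((Category.comp_id a.f).trans (Category.id_comp a.f).symm)
      (PAlg.Hom.ext a.biprodMap_biprodIso_hom)
      ((Category.comp_id a.g).trans (Category.id_comp a.g).symm))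

/-- The semidirect product construction as an equivalence between actions and split extensions. -/
def actEquivSplitExt (hP : IsZero (P.obj 0)) : Act P ≌ SplitExt P :=
  .mk (actToSplitExt P fun S => S.isSemidirect hP)
    (splitExtToAct P fun S => S.isInternalAction hP) (actUnitIso _ _) (splitExtCounitIso _ _)

end Equivalence

end OperadAction

end

theorem mainTheorem6_general {C : Type u} [Category.{v} C] [Abelian C] [HasCoproducts.{0} C]
    [MonoidalCategory C] [SymmetricCategory C] [MonoidalClosed C]
    (P : OperadAction.SymmOperad C) (hP : IsZero (P.obj 0)) :
    ∃ (hF : ∀ S : OperadAction.Act P, S.IsSemidirect)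
      (hG : ∀ S : OperadAction.SplitExt P, OperadAction.IsInternalAction S.B S.X S.ρ)
      (e : OperadAction.Act P ≌ OperadAction.SplitExt P),
      e.functor = OperadAction.actToSplitExt P hF ∧
        e.inverse = OperadAction.splitExtToAct P hG :=
  ⟨fun S => S.isSemidirect hP, fun S => S.isInternalAction hP, OperadAction.actEquivSplitExt hP,
    rfl, rfl⟩

theorem mainTheorem6 {C : Type u} [Category.{v} C] [Abelian C] [HasLimits C] [HasColimits C]
    [MonoidalCategory C] [SymmetricCategory C] [MonoidalClosed C]
    (P : OperadAction.SymmOperad C) (hP : P.IsReduced) :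
    ∃ (hF : ∀ S : OperadAction.Act P, S.IsSemidirect)
      (hG : ∀ S : OperadAction.SplitExt P, OperadAction.IsInternalAction S.B S.X S.ρ)
      (e : OperadAction.Act P ≌ OperadAction.SplitExt P),
      e.functor = OperadAction.actToSplitExt P hF ∧
        e.inverse = OperadAction.splitExtToAct P hG :=
  mainTheorem6_general P hP.isZero_zero
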